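/- Let $D\ge 1$ be an integer, $E_0,\dots,E_D\in\mathbb R$ and $\beta\in\mathbb R$. A plane tree is a rooted tree, finite or infinite, in which the children of every vertex are linearly ordered; the branching number $\deg(v)$ of a vertex $v$ is the number of its children, and its height $h(v)$ is its distance to the root. Let $\mathbb T$ be the set of plane trees all of whose branching numbers are at most $D$, $\mathbb T_N$ the set of those with exactly $N$ vertices, $S_n$ the set of those of height exactly $n$ (the maximal height of a vertex is $n$), and $S_\infty$ the set of infinite ones. For $N\ge1$ let $\mu_N$ be the Gibbs probability measure on $\mathbb T_N$, $$\mu_N\{T\}=\frac{e^{-\beta E(T)}}{\sum_{T'\in\mathbb T_N}e^{-\beta E(T')}},\qquad E(T)=\sum_{v\in V(T)}E_{\deg(v)} .$$ For $n\ge1$ let $\pi_n:\mathbb T\to\mathbb T$ map a tree to the subtree spanned by its vertices of height at most $n$. Number the vertices of height $n$ of a tree $T\in\mathbb T$ from left to right by $1,\dots,r_n$ (so $r_n\le D^n$). For $n\ge1$ and $1\le l\le r_n$ let $g_{n,l}$ be the number, among the vertices of height $n-1$, of the parent of the $l$-th vertex of height $n$, and put $g_{n,l}=0$ for $r_n<l\le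 D^n$. The map $T\mapsto (g_{n,l})_{n\ge1,\,1\le l\le D^n}$ identifies $\mathbb T$ with a subset of the compact space $$\mathbb X=\prod_{n=1}^\infty\{0,1,\dots,D^{n-1}\}^{D^n}$$ with the product of the discrete topologies, and $\mathbb T$ carries the induced $\sigma$-algebra. Then the following hold. 1. For every $n\ge1$ the measures $\mu_N\pi_n^{-1}$ converge in total variation, as $N\to\infty$, to a probability measure $P_n$ concentrated on $S_n$. 2. If $D\ge2$, these limits are given as follows. Let $$\Delta=\Big\{p\in[0,1]^{D+1}:\ \sum_{i=0}^Dp_i=1,\ \sum_{i=0}^Dip_i=1\Big\},\qquad J(p)=\sum_{i=0}^Dp_i\ln p_i+\beta\sum_{i=0}^Dp_iE_i .$$ There are a minimizer $p^*$ of $J$ on $\Delta$ and constants $C,\rho>0$ with $p^*_i=Ce^{-\beta E_i}\rho^i$ for $i=0,\dots,D$, such that, with $\sigma=e^{J(p^*)}$, for all $n\ge1$ and $\tau\in S_n$ $$P_n\{\tau\}=C\,k\,e^{-\beta\bar E(\tau)}\rho^k\sigma^{m-1},\qquad \bar E(\tau)=\sum_{v\in V(\tau),\,h(v)<n}E_{\deg(v)},$$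 where $k$ is the number of vertices of $\tau$ of height $n$ and $m$ the number of those of height less than $n$. 3. There is a unique measure $P_\infty$ on $\mathbb T$ with $P_\infty\pi_n^{-1}=P_n$ for all $n\ge1$. It is a probability measure and is concentrated on $S_\infty$. 4. As $N\to\infty$, the measures $\mu_N$, viewed as measures on $\mathbb X$, converge weakly to $P_\infty$, viewed as a measure on $\mathbb X$, in the product topology. -/

import Mathlib

open MeasureTheory Filter Topology
open scoped ENNReal

noncomputable section

/-- A plane (ordered, rooted) tree, finite or infinite, in which every vertex has at most `D`
children.  Vertices are addressed by words: `[]` is the root and `v ++ [i]` is the `(i+1)`-st child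
of `v`.  A vertex with `k` children has exactly the children `v ++ [0], …, v ++ [k-1]`, so every
plane tree with branching bounded by `D` has exactly one such representation. -/
@[ext]
structure PlaneTree (D : ℕ) where
  /-- the set of vertices -/
  verts : Set (List (Fin D))
  root_mem : [] ∈ verts
  parent_mem : ∀ (v : List (Fin D)) (i : Fin D), v ++ [i] ∈ verts → v ∈ verts
  sibling_mem : ∀ (v : List (Fin D)) (i j : Fin D), j ≤ i → v ++ [i] ∈ verts → v ++ [j] ∈ verts

namespace PlaneTree

variable {D : ℕ}

open Classical in
/-- The children of `v` in the tree `T`, listed from left to right. -/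
def children (T : PlaneTree D) (v : List (Fin D)) : List (List (Fin D)) :=
  ((List.finRange D).filter fun i => v ++ [i] ∈ T.verts).map fun i => v ++ [i]

theorem length_children_le (T : PlaneTree D) (v : List (Fin D)) : (T.children v).length ≤ D := by
  classical
  unfold children
  rw [List.length_map]
  exact (List.length_filter_le _ _).trans (List.length_finRange).le

theorem mem_children (T : PlaneTree D) (v w : List (Fin D)) :
    w ∈ T.children v ↔ ∃ i, w = v ++ [i] ∧ w ∈ T.verts := by
  classical
  unfold children
  simp only [List.mem_map, List.mem_filter, List.mem_finRange, true_and, decide_eq_true_eq]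
  constructor
  · rintro ⟨i, hi, rfl⟩
    exact ⟨i, rfl, hi⟩
  · rintro ⟨i, rfl, hi⟩
    exact ⟨i, hi, rfl⟩

/-- The branching number (number of children) of `v` in `T`. -/
def deg (T : PlaneTree D) (v : List (Fin D)) : Fin (D + 1) :=
  ⟨(T.children v).length, Nat.lt_succ_of_le (T.length_children_le v)⟩

/-- The set `𝕋_N` of plane trees on `N` vertices with branching numbers at most `D`. -/
def ofOrder (D N : ℕ) : Set (PlaneTree D) := {T | T.verts.encard = N}

/-- The root neighbourhood of radius `n`: the subtree spanned by all vertices of height at most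
`n` (the height of a vertex is the length of its word). -/
def trunc (n : ℕ) (T : PlaneTree D) : PlaneTree D where
  verts := {v | v ∈ T.verts ∧ v.length ≤ n}
  root_mem := ⟨T.root_mem, by simp⟩
  parent_mem := by
    rintro v i ⟨h, hn⟩
    refine ⟨T.parent_mem v i h, ?_⟩
    simp only [List.length_append, List.length_cons, List.length_nil] at hn
    omega
  sibling_mem := by
    rintro v i j hij ⟨h, hn⟩
    refine ⟨T.sibling_mem v i j hij h, ?_⟩
    simpa using hn

/-- The set `S_n` of plane trees of height exactly `n`, i.e. `n` is the maximal height of a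
vertex. -/
def ofHeight (D n : ℕ) : Set (PlaneTree D) :=
  {T | IsGreatest (List.length '' T.verts) n}

/-- The set `S_∞` of infinite plane trees. -/
def infiniteTrees (D : ℕ) : Set (PlaneTree D) := {T | T.verts.Infinite}

/-- The `n`-th level of `T`: its vertices of height `n`, listed from left to right. -/
def level (T : PlaneTree D) : ℕ → List (List (Fin D))
  | 0 => [[]]
  | n + 1 => (T.level n).flatMap T.children

theorem mem_level (T : PlaneTree D) (n : ℕ) (v : List (Fin D)) :
    v ∈ T.level n ↔ v ∈ T.verts ∧ v.length = n := by
  induction n generalizing v with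
  | zero =>
    simp only [level, List.mem_singleton, List.length_eq_zero_iff]
    exact ⟨fun h => ⟨h ▸ T.root_mem, h⟩, fun h => h.2⟩
  | succ n ih =>
    simp only [level, List.mem_flatMap, mem_children]
    constructor
    · rintro ⟨u, hu, i, rfl, h⟩
      exact ⟨h, by simp [((ih u).1 hu).2]⟩
    · rintro ⟨h, hn⟩
      rcases List.eq_nil_or_concat v with rfl | ⟨u, i, rfl⟩
      · simp at hn
      · refine ⟨u, (ih u).2 ⟨T.parent_mem u i (by simpa using h), by simpa using hn⟩, i, ?_, h⟩
        simp

theorem length_level_le (T : PlaneTree D) (n : ℕ) : (T.level n).length ≤ D ^ n := by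
  induction n with
  | zero => simp [level]
  | succ n ih =>
    have h : ∀ L : List (List (Fin D)), (L.flatMap T.children).length ≤ L.length * D := by
      intro L
      induction L with
      | nil => simp
      | cons v L ihL =>
        have := T.length_children_le v
        simp only [List.flatMap_cons, List.length_append, List.length_cons]
        nlinarith
    calc (T.level (n + 1)).length ≤ (T.level n).length * D := h _
      _ ≤ D ^ n * D := Nat.mul_le_mul_right _ ih
      _ = D ^ (n + 1) := (pow_succ _ _).symm

theorem dropLast_mem_level (T : PlaneTree D) {n : ℕ} {v : List (Fin D)}
    (hv : v ∈ T.level (n + 1)) : v.dropLast ∈ T.level n := by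
  simp only [level, List.mem_flatMap, mem_children] at hv
  obtain ⟨u, hu, i, rfl, -⟩ := hv
  simpa using hu

/-- The parent code: if `l < r_{n+1}`, where `r_{n+1}` is the number of vertices of height `n + 1`,
the number (counted from `1`) within level `n` of the parent of the vertex of level `n + 1` that has
number `l + 1`; and `0` otherwise. -/
def parentCode (T : PlaneTree D) (n l : ℕ) : ℕ :=
  if h : l < (T.level (n + 1)).length then
    (T.level n).idxOf ((T.level (n + 1))[l]'h).dropLast + 1
  else 0

theorem parentCode_le (T : PlaneTree D) (n l : ℕ) : T.parentCode n l ≤ D ^ n := by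
  unfold parentCode
  split_ifs with h
  · exact (Nat.succ_le_of_lt (List.idxOf_lt_length_of_mem
      (T.dropLast_mem_level (List.getElem_mem h)))).trans (T.length_level_le n)
  · exact Nat.zero_le _

end PlaneTree

/-- The compact product space `𝕏 = ∏_{n ≥ 1} {0, 1, …, D^(n-1)}^(D^n)`, with the product topology
of the discrete topologies and its product (= Borel) σ-algebra.  The factor with index `n : ℕ` is
the one for level `n + 1`. -/
abbrev CodeSpace (D : ℕ) : Type := (n : ℕ) → Fin (D ^ (n + 1)) → Fin (D ^ n + 1)

namespace PlaneTree

variable {D : ℕ}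

/-- The code `(g_1, g_2, …) ∈ 𝕏` of a plane tree, by which the set `𝕋` of all plane trees with
branching bounded by `D` is identified with a subset of `𝕏`. -/
def code (T : PlaneTree D) : CodeSpace D :=
  fun n l => ⟨T.parentCode n l, Nat.lt_succ_of_le (T.parentCode_le n l)⟩

/-- The σ-algebra on `𝕋` as a subset of `𝕏`. -/
instance : MeasurableSpace (PlaneTree D) := MeasurableSpace.comap code inferInstance

theorem measurable_code : Measurable (code : PlaneTree D → CodeSpace D) :=
  comap_measurable _

theorem children_trunc (n : ℕ) (T : PlaneTree D) (v : List (Fin D)) :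
    (trunc n T).children v = if v.length < n then T.children v else [] := by
  classical
  unfold children
  split_ifs with h
  · congr 1
    refine List.filter_congr fun i _ => ?_
    have : v ++ [i] ∈ (trunc n T).verts ↔ v ++ [i] ∈ T.verts :=
      ⟨fun h' => h'.1, fun h' => ⟨h', by simpa using h⟩⟩
    simp [this]
  · rw [List.map_eq_nil_iff, List.filter_eq_nil_iff]
    intro i _ hi
    have h' : v ++ [i] ∈ (trunc n T).verts := by simpa using hi
    have h'' := h'.2
    simp only [List.length_append, List.length_cons, List.length_nil] at h''
    omega

theorem level_trunc (n : ℕ) (T : PlaneTree D) (m : ℕ) :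
    (trunc n T).level m = if m ≤ n then T.level m else [] := by
  induction m with
  | zero => simp [level]
  | succ m ih =>
    simp only [level]
    rw [ih]
    split_ifs with h1 h2 h2
    · have : ∀ L : List (List (Fin D)), (∀ v ∈ L, v.length = m) →
          L.flatMap (trunc n T).children = L.flatMap T.children := by
        intro L hL
        induction L with
        | nil => rfl
        | cons v L ihL =>
          rw [List.flatMap_cons, List.flatMap_cons, ihL (fun w hw => hL w (by simp [hw])),
            children_trunc, if_pos (by rw [hL v (by simp)]; omega)]
      exact this _ fun v hv => ((T.mem_level m v).1 hv).2
    · rw [List.flatMap_eq_nil_iff]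
      intro v hv
      rw [children_trunc, if_neg (by rw [((T.mem_level m v).1 hv).2]; omega)]
    · omega
    · rfl

theorem code_trunc (n : ℕ) (T : PlaneTree D) (m : ℕ) :
    (trunc n T).code m = if m + 1 ≤ n then T.code m else 0 := by
  split_ifs with h
  · ext l
    simp only [code, parentCode, level_trunc, if_pos h, if_pos (show m ≤ n by omega)]
  · ext l
    simp [code, parentCode, level_trunc, h]

theorem measurable_trunc (n : ℕ) : Measurable (trunc n : PlaneTree D → PlaneTree D) := by
  refine measurable_comap_iff.2 (measurable_pi_iff.2 fun m => ?_)
  have : (fun T : PlaneTree D => (code ∘ trunc n) T m) =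
      fun T => if m + 1 ≤ n then T.code m else 0 := funext fun T => code_trunc n T m
  rw [this]
  by_cases h : m + 1 ≤ n
  · simp only [if_pos h]
    exact (measurable_pi_apply m).comp measurable_code
  · simp only [if_neg h]
    exact measurable_const

/-- The energy `E(T) = ∑_{v ∈ V(T)} E_{deg v}` of a finite tree. -/
def energy (E : Fin (D + 1) → ℝ) (T : PlaneTree D) : ℝ := ∑ᶠ v ∈ T.verts, E (T.deg v)

/-- The energy `Ē(T) = ∑_{v ∈ V(T), h(v) < n} E_{deg v}` without the vertices of height at
least `n`. -/
def innerEnergy (E : Fin (D + 1) → ℝ) (n : ℕ) (T : PlaneTree D) : ℝ :=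
  ∑ᶠ v ∈ {v | v ∈ T.verts ∧ v.length < n}, E (T.deg v)

/-- The number of vertices of height `n`. -/
def numAt (n : ℕ) (T : PlaneTree D) : ℕ := {v | v ∈ T.verts ∧ v.length = n}.ncard

/-- The number of vertices of height less than `n`. -/
def numBelow (n : ℕ) (T : PlaneTree D) : ℕ := {v | v ∈ T.verts ∧ v.length < n}.ncard

open Classical in
/-- The Boltzmann weight `e^{-β E(T)}` of the trees `T` on `N` vertices (`0` for other trees). -/
def weight (E : Fin (D + 1) → ℝ) (β : ℝ) (N : ℕ) (T : PlaneTree D) : ℝ≥0∞ :=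
  if T ∈ ofOrder D N then ENNReal.ofReal (Real.exp (-β * T.energy E)) else 0

theorem take_mem (T : PlaneTree D) {v : List (Fin D)} (hv : v ∈ T.verts) (k : ℕ) :
    v.take k ∈ T.verts := by
  induction v using List.reverseRecOn with
  | nil => simpa using hv
  | append_singleton u i ih =>
    by_cases hk : k ≤ u.length
    · rw [List.take_append_of_le_length hk]
      exact ih (T.parent_mem u i hv)
    · rw [List.take_of_length_le (by simp; omega)]
      exact hv

theorem finite_ofOrder (D N : ℕ) : (ofOrder D N).Finite := by
  have hfin : {v : List (Fin D) | v.length ≤ N}.Finite := List.finite_length_le (Fin D) N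
  refine Set.Finite.of_finite_image (f := PlaneTree.verts) (hfin.finite_subsets.subset ?_)
    (fun S _ T _ h => PlaneTree.ext h)
  rintro _ ⟨T, hT, rfl⟩ v hv
  have hinj : Function.Injective fun k : Fin (v.length + 1) => v.take k := by
    intro a b hab
    have := congrArg List.length hab
    simp only [List.length_take] at this
    ext
    omega
  have h1 : (Set.range fun k : Fin (v.length + 1) => v.take k).encard ≤ T.verts.encard := by
    apply Set.encard_le_encard
    rintro _ ⟨k, rfl⟩
    exact T.take_mem hv k
  have h2 : (Set.range fun k : Fin (v.length + 1) => v.take k).encard = (v.length + 1 : ℕ) := by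
    rw [← Set.image_univ, hinj.encard_image, Set.encard_univ, ENat.card_eq_coe_fintype_card,
      Fintype.card_fin]
  have h3 : T.verts.encard = N := hT
  rw [h2, h3, Nat.cast_le] at h1
  show v.length ≤ N
  omega

theorem nonempty_ofOrder (D : ℕ) (hD : 1 ≤ D) (N : ℕ+) : (ofOrder D N).Nonempty := by
  let z : Fin D := ⟨0, hD⟩
  have key : ∀ (v : List (Fin D)) (i : Fin D) (k : ℕ),
      List.replicate k z = v ++ [i] → i = z ∧ ∃ j, k = j + 1 ∧ v = List.replicate j z := by
    intro v i k h
    have hall : ∀ x ∈ v ++ [i], x = z := by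
      rw [← h]
      exact fun x hx => List.eq_of_mem_replicate hx
    have hlen : k = v.length + 1 := by simpa using congrArg List.length h
    exact ⟨hall i (by simp), v.length, hlen,
      List.eq_replicate_iff.2 ⟨rfl, fun x hx => hall x (by simp [hx])⟩⟩
  refine ⟨⟨(fun k => List.replicate k z) '' {k : ℕ | k < N}, ⟨0, N.pos, rfl⟩, ?_, ?_⟩, ?_⟩
  · rintro v i ⟨k, hk, h⟩
    obtain ⟨-, j, rfl, rfl⟩ := key v i k h
    exact ⟨j, lt_of_le_of_lt (Nat.le_succ j) hk, rfl⟩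
  · rintro v i j hij ⟨k, hk, h⟩
    obtain ⟨rfl, -⟩ := key v i k h
    have : j = z := le_antisymm hij (Fin.mk_le_of_le_val (Nat.zero_le _))
    subst this
    exact ⟨k, hk, h⟩
  · show Set.encard _ = _
    rw [Function.Injective.encard_image (fun a b h => by simpa using congrArg List.length h)]
    have : {k : ℕ | k < N} = ↑(Finset.range (N : ℕ)) := by ext; simp
    rw [this, Set.encard_coe_eq_coe_finsetCard, Finset.card_range]

theorem tsum_weight_ne_zero (hD : 1 ≤ D) (E : Fin (D + 1) → ℝ) (β : ℝ) (N : ℕ+) :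
    ∑' T, weight E β N T ≠ 0 := by
  obtain ⟨T, hT⟩ := nonempty_ofOrder D hD N
  rw [Ne, ENNReal.tsum_eq_zero]
  intro h
  have hw := h T
  rw [weight, if_pos hT, ENNReal.ofReal_eq_zero] at hw
  exact absurd hw (not_le.2 (Real.exp_pos _))

theorem tsum_weight_ne_top (E : Fin (D + 1) → ℝ) (β : ℝ) (N : ℕ) :
    ∑' T, weight E β N T ≠ ∞ := by
  rw [tsum_eq_sum (s := (finite_ofOrder D N).toFinset) (fun T hT => by
    rw [weight, if_neg (by simpa using hT)])]
  refine ENNReal.sum_ne_top.2 fun T _ => ?_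
  unfold weight
  split_ifs
  · exact ENNReal.ofReal_ne_top
  · exact ENNReal.zero_ne_top

/-- The Gibbs distribution on `𝕋_N` as a probability mass function:
`μ_N{T} = e^{-β E(T)} / Z_N` for `T ∈ 𝕋_N`, with `Z_N = ∑_{T ∈ 𝕋_N} e^{-β E(T)}`. -/
def gibbsPMF (hD : 1 ≤ D) (E : Fin (D + 1) → ℝ) (β : ℝ) (N : ℕ+) : PMF (PlaneTree D) :=
  PMF.normalize (weight E β N) (tsum_weight_ne_zero hD E β N) (tsum_weight_ne_top E β N)

/-- The Gibbs probability measure `μ_N`, as a measure on `𝕋` that lives on `𝕋_N`. -/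
def gibbs (hD : 1 ≤ D) (E : Fin (D + 1) → ℝ) (β : ℝ) (N : ℕ+) :
    ProbabilityMeasure (PlaneTree D) :=
  ⟨(gibbsPMF hD E β N).toMeasure, inferInstance⟩

/-- The image `P π_n^{-1}` of a probability measure `P` on `𝕋` under the map `π_n` that takes a tree
to its root neighbourhood of radius `n`. -/
def mapTrunc (P : ProbabilityMeasure (PlaneTree D)) (n : ℕ) : ProbabilityMeasure (PlaneTree D) :=
  P.map (measurable_trunc n).aemeasurable

/-- A probability measure on `𝕋`, viewed as a measure on `𝕏`. -/
def toCodeSpace (P : ProbabilityMeasure (PlaneTree D)) : ProbabilityMeasure (CodeSpace D) :=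
  P.map measurable_code.aemeasurable

end PlaneTree

/-- The total variation distance `sup_A |μ(A) - ν(A)|` over measurable sets `A`. -/
def tvDistance {α : Type*} [MeasurableSpace α] (μ ν : ProbabilityMeasure α) : ℝ :=
  ⨆ A : {A : Set α // MeasurableSet A}, |(μ : Measure α).real A - (ν : Measure α).real A|

/-- The set `Δ` of probability vectors on `{0, …, D}` with mean one. -/
def meanOneSimplex (D : ℕ) : Set (Fin (D + 1) → ℝ) :=
  {p | (∀ i, p i ∈ Set.Icc 0 1) ∧ ∑ i, p i = 1 ∧ ∑ i : Fin (D + 1), ((i : ℕ) : ℝ) * p i = 1}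

/-- The function `J(p) = -H(p) + β E(p)`, where `H(p) = -∑ p_i ln p_i` and `E(p) = ∑ p_i E_i`. -/
def freeEnergy {D : ℕ} (E : Fin (D + 1) → ℝ) (β : ℝ) (p : Fin (D + 1) → ℝ) : ℝ :=
  -(-∑ i, p i * Real.log (p i)) + β * ∑ i, p i * E i

end

open MeasureTheory Filter Topology
open scoped ENNReal

noncomputable section

/-! ### Polynomials and power series with nonnegative coefficients -/

namespace Polynomial

/-! Let `Z` be the generating function of the Boltzmann weights of finite trees. Splitting a tree at
its root gives `Z = x ∑ e^{-β E_d} Z^d`. The trees whose neighbourhood of radius `n` is `τ` arise by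
grafting a tree onto each of the `k` vertices of height `n`, so they have generating function `e^{-β
Ē(τ)} x^m Z^k` (`genFun_trunc_eq`). Hence `μ_N π_n^{-1}{τ}` is a quotient of coefficients, and part
1 asks for the limit of `[x^{N-m}] Z^k / [x^N] Z`.

For `D ≥ 2` the substitution `Q(x) = ρ⁻¹ Z(C ρ x)` turns the equation into `Q = x φ(Q)` with `φ` the
generating function of `p*`, a critical offspring law. The minimizing property of `p*` is Gibbs'
inequality, and `σ = C ρ`. What remains is `[x^{N-m}] Q^k / [x^N] Q → k`: a large forest has exactly
one large tree, which can be any of the `k`.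

This rests on the ratio limit `q_n / q_{n+1} → 1` for the coefficients `q_n` of `Q`. They decay
slower than any exponential, since `Q` has radius of convergence 1 and `q` is almost
supermultiplicative (`eventually_lt_coeff`). Summing out runs of vertices with one child and
applying the Cauchy–Schwarz inequality shows that the ratios cannot grow fast (`sq_coeff_le`).
Together these force the limit (`tendsto_ratio_of_subexponential`). Lower bounds for the
coefficients of `Q^k` follow by keeping the terms with one large factor. Criticality makes the bound
sharp for `k = 2`, and the other powers follow from this. For `D = 1` all trees are paths and the
quotient is eventually constant.

Since the limit weight has the factor `k`, `P_n` charges only trees of height `n`. For parts 3 and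
4, `𝕏` is compact and the codes of trees form a closed subset, so every cluster point of `μ_N` is a
law on trees. Its images under `π_n` are the `P_n`, and these determine it. Thus there is exactly
one cluster point, and it is the limit. -/

theorem coeff_mul_nonneg {f g : ℝ[X]} (hf : ∀ i, 0 ≤ f.coeff i) (hg : ∀ i, 0 ≤ g.coeff i)
    (i : ℕ) : 0 ≤ (f * g).coeff i := by
  rw [coeff_mul]
  exact Finset.sum_nonneg fun x _ => mul_nonneg (hf _) (hg _)

theorem coeff_pow_nonneg {f : ℝ[X]} (hf : ∀ i, 0 ≤ f.coeff i) (k i : ℕ) :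
    0 ≤ (f ^ k).coeff i := by
  induction k generalizing i with
  | zero =>
    rw [pow_zero, coeff_one]
    split_ifs <;> norm_num
  | succ k ih =>
    rw [pow_succ]
    exact coeff_mul_nonneg ih hf i

theorem coeff_comp_nonneg {f g : ℝ[X]} (hf : ∀ i, 0 ≤ f.coeff i) (hg : ∀ i, 0 ≤ g.coeff i)
    (i : ℕ) : 0 ≤ (f.comp g).coeff i := by
  rw [comp, eval₂_eq_sum_range, finsetSum_coeff]
  refine Finset.sum_nonneg fun k _ => ?_
  rw [coeff_C_mul]
  exact mul_nonneg (hf k) (coeff_pow_nonneg hg k i)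

theorem eval_nonneg_of_coeff_nonneg {f : ℝ[X]} (hf : ∀ i, 0 ≤ f.coeff i) {x : ℝ} (hx : 0 ≤ x) :
    0 ≤ f.eval x := by
  rw [eval_eq_sum_range]
  exact Finset.sum_nonneg fun k _ => mul_nonneg (hf k) (pow_nonneg hx k)

theorem eval_mono_of_coeff_nonneg {f : ℝ[X]} (hf : ∀ i, 0 ≤ f.coeff i) {x y : ℝ} (hx : 0 ≤ x)
    (hxy : x ≤ y) : f.eval x ≤ f.eval y := by
  rw [eval_eq_sum_range, eval_eq_sum_range]
  exact Finset.sum_le_sum fun k _ => mul_le_mul_of_nonneg_left (pow_le_pow_left₀ hx hxy k) (hf k)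

end Polynomial

namespace PowerSeries

theorem coeff_mul_nonneg {f g : ℝ⟦X⟧} (hf : ∀ n, 0 ≤ coeff n f) (hg : ∀ n, 0 ≤ coeff n g)
    (n : ℕ) : 0 ≤ coeff n (f * g) := by
  rw [coeff_mul]
  exact Finset.sum_nonneg fun x _ => mul_nonneg (hf _) (hg _)

theorem coeff_pow_nonneg {f : ℝ⟦X⟧} (hf : ∀ n, 0 ≤ coeff n f) (k n : ℕ) :
    0 ≤ coeff n (f ^ k) := by
  induction k generalizing n with
  | zero =>
    rw [pow_zero, coeff_one]
    split_ifs <;> norm_num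
  | succ k ih =>
    rw [pow_succ]
    exact coeff_mul_nonneg ih hf n

theorem coeff_aeval (f : ℝ⟦X⟧) (φ : Polynomial ℝ) (n : ℕ) :
    coeff n (Polynomial.aeval f φ) =
      ∑ k ∈ Finset.range (φ.natDegree + 1), φ.coeff k * coeff n (f ^ k) := by
  rw [Polynomial.aeval_eq_sum_range, map_sum]
  exact Finset.sum_congr rfl fun k _ => by rw [coeff_smul, smul_eq_mul]

theorem sub_dvd_aeval_sub (f g : ℝ⟦X⟧) (φ : Polynomial ℝ) :
    f - g ∣ Polynomial.aeval f φ - Polynomial.aeval g φ := by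
  have h := Polynomial.sub_dvd_eval_sub f g (φ.map (algebraMap ℝ ℝ⟦X⟧))
  rwa [Polynomial.eval_map_algebraMap, Polynomial.eval_map_algebraMap] at h

/-- Polynomial approximations of the solution of a fixed point equation. -/
theorem exists_approx_of_fixed {ψ : Polynomial ℝ} {Y Q : ℝ⟦X⟧} (hψ : ∀ i, 0 ≤ ψ.coeff i)
    (hY : X ∣ Y) (hQ : Q = Y * Polynomial.aeval Q ψ) (j : ℕ) :
    ∃ R : Polynomial ℝ, (∀ i, 0 ≤ R.coeff i) ∧ X ^ j ∣ Q - Polynomial.aeval Y R ∧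
      (ψ.eval 1 ≤ 1 → R.eval 1 ≤ 1) := by
  induction j with
  | zero => exact ⟨0, by simp, by simp, by simp⟩
  | succ j ih =>
    obtain ⟨R, h0, h1, h2⟩ := ih
    -- Picard iteration for `Q = Y ψ(Q)`: the factor `Y`, divisible by `X`, gains one order per
    -- step.
    refine ⟨Polynomial.X * ψ.comp R, ?_, ?_, ?_⟩
    · intro i
      refine Polynomial.coeff_mul_nonneg (fun i => ?_) (Polynomial.coeff_comp_nonneg hψ h0) i
      rw [Polynomial.coeff_X]
      split_ifs <;> norm_num
    · have : Q - Polynomial.aeval Y (Polynomial.X * ψ.comp R) =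
          Y * (Polynomial.aeval Q ψ - Polynomial.aeval (Polynomial.aeval Y R) ψ) := by
        rw [map_mul, Polynomial.aeval_X, Polynomial.aeval_comp, mul_sub, ← hQ]
      rw [this, pow_succ']
      exact mul_dvd_mul hY (h1.trans (sub_dvd_aeval_sub _ _ _))
    · intro h
      rw [Polynomial.eval_mul, Polynomial.eval_X, one_mul, Polynomial.eval_comp]
      exact (Polynomial.eval_mono_of_coeff_nonneg hψ
        (Polynomial.eval_nonneg_of_coeff_nonneg h0 zero_le_one) (h2 h)).trans h

theorem coeff_eq_of_X_pow_dvd_sub {f g : ℝ⟦X⟧} {j n : ℕ} (h : X ^ j ∣ f - g) (hn : n < j) :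
    coeff n f = coeff n g := by
  have := X_pow_dvd_iff.1 h n hn
  rwa [map_sub, sub_eq_zero] at this

/-! ### The geometric series and a Cauchy–Schwarz inequality for coefficients -/

/-- The series `x / (1 - p x)`. -/
def geomSeries (p : ℝ) : ℝ⟦X⟧ := X * mk fun n => p ^ n

theorem geomSeries_mul (p : ℝ) : geomSeries p * (1 - C p * X) = X := by
  have : (mk fun n => p ^ n) * (1 - C p * X) = (1 : ℝ⟦X⟧) := by
    ext n
    rw [mul_sub, mul_one, map_sub, mul_left_comm, coeff_C_mul, coeff_one]
    cases n with
    | zero => simp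
    | succ n => rw [coeff_succ_mul_X, coeff_mk, coeff_mk, pow_succ']; simp
  rw [geomSeries, mul_assoc, this, mul_one]

theorem coeff_geomSeries_nonneg {p : ℝ} (hp : 0 ≤ p) (n : ℕ) : 0 ≤ coeff n (geomSeries p) := by
  rw [geomSeries]
  cases n with
  | zero => simp
  | succ n =>
    rw [coeff_succ_X_mul, coeff_mk]
    exact pow_nonneg hp n

theorem one_sub_C_mul_X_ne_zero (p : ℝ) : (1 - C p * X : ℝ⟦X⟧) ≠ 0 := by
  intro h
  have := congrArg (coeff 0) h
  simp at this

/-- With `Y = x / (1 - p x)` one has `x Y' (1 - p x) = Y`, hence `x (Y^M)' (1 - p x) = M Y^M`;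
compare the coefficients of `x^{n+1}`. -/
theorem coeff_succ_geomSeries_pow (p : ℝ) (M n : ℕ) :
    ((n : ℝ) + 1 - M) * coeff (n + 1) (geomSeries p ^ M) =
      n * p * coeff n (geomSeries p ^ M) := by
  set Y := geomSeries p with hYdef
  have hY : Y * (1 - C p * X) = X := geomSeries_mul p
  have hd : X * d⁄dX ℝ Y * (1 - C p * X) = Y := by
    have h1 := congrArg (d⁄dX ℝ) hY
    simp only [Derivation.leibniz, map_sub, smul_eq_mul, derivative_X, derivative_C,
      Derivation.map_one_eq_zero] at h1
    linear_combination X * h1 - hY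
  have hM : X * d⁄dX ℝ (Y ^ M) * (1 - C p * X) = (M : ℝ⟦X⟧) * Y ^ M := by
    rw [Derivation.leibniz_pow]
    cases M with
    | zero => simp
    | succ M =>
      simp only [nsmul_eq_mul, smul_eq_mul, Nat.add_sub_cancel]
      linear_combination ((M + 1 : ℕ) : ℝ⟦X⟧) * Y ^ M * hd
  have hc := congrArg (coeff (n + 1)) hM
  have e : X * d⁄dX ℝ (Y ^ M) * (1 - C p * X) =
      X * d⁄dX ℝ (Y ^ M) - C p * (X * (X * d⁄dX ℝ (Y ^ M))) := by ring
  have e2 : ((M : ℕ) : ℝ⟦X⟧) = C (M : ℝ) := by simp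
  rw [e, map_sub, coeff_C_mul, coeff_succ_X_mul, coeff_succ_X_mul, coeff_derivative, e2,
    coeff_C_mul] at hc
  have h3 : coeff n (X * d⁄dX ℝ (Y ^ M)) = n * coeff n (Y ^ M) := by
    cases n with
    | zero => simp
    | succ n => rw [coeff_succ_X_mul, coeff_derivative]; push_cast; ring
  rw [h3] at hc
  linear_combination hc

/-- Cauchy–Schwarz for the function `M ↦ n + 2 - M` and the weights `R_M [x^{n+2}] Y^M`. The
recurrence `coeff_succ_geomSeries_pow` expresses its first and second moments through the
coefficients of `f` of orders `n` and `n + 1`. -/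
theorem sq_coeff_le_of_geomSeries {p : ℝ} (hp : 0 ≤ p) {R : Polynomial ℝ}
    (hR : ∀ i, 0 ≤ R.coeff i) {f : ℝ⟦X⟧} (hf : f = Polynomial.aeval (geomSeries p) R) (n : ℕ) :
    (((n : ℝ) + 1) * p * coeff (n + 1) f) ^ 2 ≤ coeff (n + 2) f *
      (((n : ℝ) + 1) * p * (coeff (n + 1) f + n * p * coeff n f)) := by
  set b : ℕ → ℕ → ℝ := fun M n => coeff n (geomSeries p ^ M) with hb
  have hb0 : ∀ M n, 0 ≤ b M n := fun M n => coeff_pow_nonneg (coeff_geomSeries_nonneg hp) M n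
  have hrec : ∀ M n : ℕ, ((n : ℝ) + 1 - M) * b M (n + 1) = n * p * b M n :=
    coeff_succ_geomSeries_pow p
  have hc : ∀ m, coeff m f = ∑ M ∈ Finset.range (R.natDegree + 1), R.coeff M * b M m :=
    fun m => by rw [hf, coeff_aeval]
  have h1 : ((n : ℝ) + 1) * p * coeff (n + 1) f = ∑ M ∈ Finset.range (R.natDegree + 1),
      R.coeff M * (((n : ℝ) + 2 - M) * b M (n + 2)) := by
    rw [hc, Finset.mul_sum]
    refine Finset.sum_congr rfl fun M _ => ?_
    have := hrec M (n + 1)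
    push_cast at this
    linear_combination -R.coeff M * this
  have h2 : ((n : ℝ) + 1) * p * (coeff (n + 1) f + n * p * coeff n f) =
      ∑ M ∈ Finset.range (R.natDegree + 1),
        R.coeff M * (((n : ℝ) + 2 - M) ^ 2 * b M (n + 2)) := by
    rw [hc, hc, Finset.mul_sum, ← Finset.sum_add_distrib, Finset.mul_sum]
    refine Finset.sum_congr rfl fun M _ => ?_
    have h := hrec M (n + 1)
    have h' := hrec M n
    push_cast at h
    linear_combination -R.coeff M * ((n : ℝ) + 2 - M) * h - R.coeff M * ((n : ℝ) + 1) * p * h'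
  rw [h1, h2, hc]
  refine Finset.sum_sq_le_sum_mul_sum_of_sq_le_mul _ (fun M _ => ?_) (fun M _ => ?_) fun M _ => ?_
  · exact mul_nonneg (hR M) (hb0 _ _)
  · exact mul_nonneg (hR M) (mul_nonneg (sq_nonneg _) (hb0 _ _))
  · exact le_of_eq (by ring)

theorem hasSum_coeff_mul {f g : ℝ⟦X⟧} {a b : ℝ} (hf : HasSum (fun n => coeff n f) a)
    (hg : HasSum (fun n => coeff n g) b) : HasSum (fun n => coeff n (f * g)) (a * b) := by
  have hf' := summable_norm_iff.2 hf.summable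
  have hg' := summable_norm_iff.2 hg.summable
  have h1 := tsum_mul_tsum_eq_tsum_sum_antidiagonal_of_summable_norm hf' hg'
  have h2 := (summable_norm_sum_mul_antidiagonal_of_summable_norm hf' hg').of_norm
  simp only [coeff_mul]
  rw [← hf.tsum_eq, ← hg.tsum_eq, h1]
  exact h2.hasSum

theorem hasSum_coeff_one : HasSum (fun n => coeff n (1 : ℝ⟦X⟧)) 1 := by
  have := hasSum_single (f := fun n => coeff n (1 : ℝ⟦X⟧)) 0
    (fun n hn => by simp [coeff_one, hn])
  simpa using this

theorem hasSum_coeff_X : HasSum (fun n => coeff n (X : ℝ⟦X⟧)) 1 := by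
  have := hasSum_single (f := fun n => coeff n (X : ℝ⟦X⟧)) 1
    (fun n hn => by simp [coeff_X, hn])
  simpa using this

theorem hasSum_coeff_pow {f : ℝ⟦X⟧} {a : ℝ} (hf : HasSum (fun n => coeff n f) a) (k : ℕ) :
    HasSum (fun n => coeff n (f ^ k)) (a ^ k) := by
  induction k with
  | zero => simpa using hasSum_coeff_one
  | succ k ih =>
    rw [pow_succ, pow_succ]
    exact hasSum_coeff_mul ih hf

theorem hasSum_coeff_aeval {f : ℝ⟦X⟧} {a : ℝ} (hf : HasSum (fun n => coeff n f) a)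
    (φ : Polynomial ℝ) : HasSum (fun n => coeff n (Polynomial.aeval f φ)) (φ.eval a) := by
  simp only [coeff_aeval]
  rw [Polynomial.eval_eq_sum_range]
  exact hasSum_sum fun k _ => (hasSum_coeff_pow hf k).mul_left _

end PowerSeries

/-! ### Total progeny of a critical branching process -/

open PowerSeries in
/-- `Q` is the generating function of the total progeny of a critical branching process whose
offspring distribution has the generating function `φ`. -/
structure IsCriticalProgeny (φ : Polynomial ℝ) (Q : ℝ⟦X⟧) : Prop where
  nonneg : ∀ i, 0 ≤ φ.coeff i
  zero_pos : 0 < φ.coeff 0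
  one_pos : 0 < φ.coeff 1
  two_pos : 0 < φ.coeff 2
  eval_one : φ.eval 1 = 1
  eval_derivative : φ.derivative.eval 1 = 1
  fixed : Q = X * Polynomial.aeval Q φ
  pos : ∀ n, 0 < coeff (n + 1) Q

namespace IsCriticalProgeny

open PowerSeries

variable {φ : Polynomial ℝ} {Q : ℝ⟦X⟧}

theorem coeff_zero (h : IsCriticalProgeny φ Q) : coeff 0 Q = 0 := by
  rw [h.fixed, coeff_zero_X_mul]

theorem coeff_nonneg (h : IsCriticalProgeny φ Q) (n : ℕ) : 0 ≤ coeff n Q := by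
  cases n with
  | zero => exact h.coeff_zero.ge
  | succ n => exact (h.pos n).le

theorem sum_coeff_mul (h : IsCriticalProgeny φ Q) :
    ∑ k ∈ Finset.range (φ.natDegree + 1), φ.coeff k * k = 1 := by
  have h1 := h.eval_derivative
  rw [Polynomial.derivative_eval, Polynomial.sum_over_range _ (by simp)] at h1
  simpa using h1

theorem sum_coeff (h : IsCriticalProgeny φ Q) :
    ∑ k ∈ Finset.range (φ.natDegree + 1), φ.coeff k = 1 := by
  have h1 := h.eval_one
  rw [Polynomial.eval_eq_sum_range] at h1
  simpa using h1

theorem two_mem (h : IsCriticalProgeny φ Q) : 2 ∈ Finset.range (φ.natDegree + 1) :=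
  Finset.mem_range_succ_iff.2 (Polynomial.le_natDegree_of_ne_zero h.two_pos.ne')

theorem coeff_one_lt_one (h : IsCriticalProgeny φ Q) : φ.coeff 1 < 1 := by
  have h1 := h.sum_coeff
  have h2 : ({0, 1} : Finset ℕ) ⊆ Finset.range (φ.natDegree + 1) := by
    have := Finset.mem_range.1 h.two_mem
    intro x hx
    simp only [Finset.mem_insert, Finset.mem_singleton] at hx
    rw [Finset.mem_range]
    omega
  have h3 := Finset.sum_le_sum_of_subset_of_nonneg h2 fun i _ _ => h.nonneg i
  rw [h1, Finset.sum_pair zero_ne_one] at h3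
  linarith [h.zero_pos]

/-- Since `φ(1) = φ'(1) = 1`, the diagonal is tangent to `φ` at 1. Bernoulli's inequality bounds
each monomial below by its tangent; the quadratic one is kept exactly, which makes the contact
strict. -/
theorem le_eval (h : IsCriticalProgeny φ Q) {y : ℝ} (hy : 0 ≤ y) :
    y + φ.coeff 2 * (y - 1) ^ 2 ≤ φ.eval y := by
  have h1 := h.sum_coeff
  have h2 := h.sum_coeff_mul
  rw [Polynomial.eval_eq_sum_range]
  have h3 : ∑ k ∈ Finset.range (φ.natDegree + 1), (φ.coeff k * (1 + k * (y - 1)) +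
      if k = 2 then φ.coeff 2 * (y - 1) ^ 2 else 0) = y + φ.coeff 2 * (y - 1) ^ 2 := by
    rw [Finset.sum_add_distrib, Finset.sum_ite_eq' _ 2, if_pos h.two_mem]
    congr 1
    calc _ = ∑ k ∈ Finset.range (φ.natDegree + 1), φ.coeff k +
          (∑ k ∈ Finset.range (φ.natDegree + 1), φ.coeff k * k) * (y - 1) := by
          rw [Finset.sum_mul, ← Finset.sum_add_distrib]
          exact Finset.sum_congr rfl fun k _ => by ring
      _ = y := by rw [h1, h2]; ring
  rw [← h3]
  refine Finset.sum_le_sum fun k _ => ?_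
  split_ifs with hk
  · subst hk
    exact le_of_eq (by push_cast; ring)
  · rw [add_zero]
    refine mul_le_mul_of_nonneg_left ?_ (h.nonneg k)
    have := one_add_mul_le_pow (a := y - 1) (by linarith) k
    simpa using this

/-- The partial sums of `Q` are sums of coefficients of polynomial approximations `R` with `R(1) ≤
1`. -/
theorem summable (h : IsCriticalProgeny φ Q) : Summable fun n => coeff n Q := by
  refine summable_of_sum_range_le (c := 1) h.coeff_nonneg fun j => ?_
  obtain ⟨R, h0, h1, h2⟩ := exists_approx_of_fixed h.nonneg dvd_rfl h.fixed j
  have h3 : ∀ n < j, coeff n Q = R.coeff n := by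
    intro n hn
    rw [coeff_eq_of_X_pow_dvd_sub h1 hn]
    have : Polynomial.aeval (X : ℝ⟦X⟧) R = (R : ℝ⟦X⟧) := by
      rw [Polynomial.aeval_def, ← Polynomial.eval₂_C_X_eq_coe]
      rfl
    rw [this, Polynomial.coeff_coe]
  refine le_trans ?_ (h2 h.eval_one.le)
  rw [Finset.sum_congr rfl fun n hn => h3 n (Finset.mem_range.1 hn),
    Polynomial.eval_eq_sum_range]
  simp only [one_pow, mul_one]
  have h4 : ∑ n ∈ Finset.range j, R.coeff n =
      ∑ n ∈ Finset.range j ∩ Finset.range (R.natDegree + 1), R.coeff n := by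
    symm
    refine Finset.sum_subset Finset.inter_subset_left fun n hn hn' => ?_
    refine Polynomial.coeff_eq_zero_of_natDegree_lt ?_
    simp only [Finset.mem_inter, Finset.mem_range, not_and, not_lt] at hn hn'
    exact hn' hn
  rw [h4]
  exact Finset.sum_le_sum_of_subset_of_nonneg Finset.inter_subset_right fun n _ _ => h0 n

/-- The total mass is a fixed point of `φ`, and by `le_eval` the only nonnegative one is 1. -/
theorem hasSum (h : IsCriticalProgeny φ Q) : HasSum (fun n => coeff n Q) 1 := by
  obtain ⟨y, hy⟩ := h.summable
  have hy0 : 0 ≤ y := hy.nonneg h.coeff_nonneg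
  have h1 : HasSum (fun n => coeff n Q) (1 * φ.eval y) := by
    have := hasSum_coeff_mul hasSum_coeff_X (hasSum_coeff_aeval hy φ)
    rwa [← h.fixed] at this
  have h2 : y = φ.eval y := by simpa using hy.unique h1
  have h3 := h.le_eval hy0
  have h4 : (y - 1) ^ 2 ≤ 0 := by nlinarith [h.two_pos]
  have h5 : y = 1 := by
    have := pow_eq_zero_iff (two_ne_zero) |>.1 (le_antisymm h4 (sq_nonneg _))
    linarith
  rwa [h5] at hy

theorem coeff_le_one (h : IsCriticalProgeny φ Q) (n : ℕ) : coeff n Q ≤ 1 :=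
  le_hasSum h.hasSum n fun m _ => h.coeff_nonneg m

/-- A finite value `y > 0` of `Q` at `x > 1` would satisfy `y = x φ(y) ≥ x y`. -/
theorem not_summable (h : IsCriticalProgeny φ Q) {x : ℝ} (hx : 1 < x) :
    ¬ Summable fun n => x ^ n * coeff n Q := by
  rintro ⟨y, hy⟩
  have hy0 : 0 < y := by
    refine lt_of_lt_of_le ?_ (le_hasSum hy 1 fun m _ =>
      mul_nonneg (pow_nonneg (by linarith) m) (h.coeff_nonneg m))
    exact mul_pos (by simpa using by linarith) (h.pos 0)
  have hy' : HasSum (fun n => coeff n (rescale x Q)) y := by simpa [coeff_rescale] using hy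
  have hfix : rescale x Q = C x * (X * Polynomial.aeval (rescale x Q) φ) := by
    conv_lhs => rw [h.fixed]
    rw [map_mul, rescale_X, mul_assoc, Polynomial.aeval_eq_sum_range, map_sum,
      Polynomial.aeval_eq_sum_range]
    congr 2
    refine Finset.sum_congr rfl fun k _ => ?_
    rw [← map_pow]
    ext n
    simp only [coeff_rescale, coeff_smul, smul_eq_mul]
    ring
  have h1 : HasSum (fun n => coeff n (rescale x Q)) (x * (1 * φ.eval y)) := by
    have := (hasSum_coeff_mul hasSum_coeff_X (hasSum_coeff_aeval hy' φ)).mul_left x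
    rw [hfix]
    simpa only [coeff_C_mul] using this
  have h2 : y = x * φ.eval y := by simpa using hy'.unique h1
  have h3 := h.le_eval hy0.le
  have h4 : 0 ≤ φ.coeff 2 * (y - 1) ^ 2 := mul_nonneg h.two_pos.le (sq_nonneg _)
  nlinarith

theorem coeff_succ (h : IsCriticalProgeny φ Q) (n : ℕ) : coeff (n + 1) Q =
    ∑ k ∈ Finset.range (φ.natDegree + 1), φ.coeff k * coeff n (Q ^ k) := by
  conv_lhs => rw [h.fixed]
  rw [coeff_succ_X_mul, coeff_aeval]

theorem mul_coeff_le_coeff_succ (h : IsCriticalProgeny φ Q) (k n : ℕ) :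
    φ.coeff k * coeff n (Q ^ k) ≤ coeff (n + 1) Q := by
  by_cases hk : k ∈ Finset.range (φ.natDegree + 1)
  · rw [h.coeff_succ]
    exact Finset.single_le_sum (f := fun k => φ.coeff k * coeff n (Q ^ k))
      (fun i _ => mul_nonneg (h.nonneg i) (coeff_pow_nonneg h.coeff_nonneg i n)) hk
  · rw [Polynomial.coeff_eq_zero_of_natDegree_lt (by simpa using hk), zero_mul]
    exact h.coeff_nonneg _

theorem coeff_one_mul_le (h : IsCriticalProgeny φ Q) (n : ℕ) :
    φ.coeff 1 * coeff n Q ≤ coeff (n + 1) Q := by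
  simpa using h.mul_coeff_le_coeff_succ 1 n

/-- Almost supermultiplicativity: a root with two children joins a tree of size `m` and one of size
`n`. -/
theorem coeff_two_mul_le (h : IsCriticalProgeny φ Q) (m n : ℕ) :
    φ.coeff 2 * (coeff m Q * coeff n Q) ≤ coeff (m + n + 1) Q := by
  refine le_trans (mul_le_mul_of_nonneg_left ?_ h.two_pos.le) (h.mul_coeff_le_coeff_succ 2 (m + n))
  rw [sq, coeff_mul]
  exact Finset.single_le_sum (f := fun x : ℕ × ℕ => coeff x.1 Q * coeff x.2 Q)
    (fun i _ => mul_nonneg (h.coeff_nonneg _) (h.coeff_nonneg _))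
    (Finset.HasAntidiagonal.mem_antidiagonal.2 (rfl : (m, n).1 + (m, n).2 = m + n))

theorem exists_large_coeff (h : IsCriticalProgeny φ Q) {s : ℝ} (hs : 1 < s) :
    ∃ n, 1 ≤ φ.coeff 2 * coeff n Q * s ^ (n + 1) := by
  by_contra! hcon
  obtain ⟨t, ht1, hts⟩ := exists_between hs
  refine h.not_summable ht1 ?_
  have hgeom : Summable fun n : ℕ => (φ.coeff 2)⁻¹ * (t / s) ^ n :=
    (summable_geometric_of_lt_one (by positivity) ((div_lt_one (by linarith)).2 hts)).mul_left _
  refine Summable.of_nonneg_of_le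
    (fun n => mul_nonneg (pow_nonneg (by linarith) n) (h.coeff_nonneg n)) (fun n => ?_) hgeom
  have h1 := hcon n
  have h2 : φ.coeff 2 * coeff n Q * s ^ n ≤ 1 := by
    refine le_trans ?_ h1.le
    exact mul_le_mul_of_nonneg_left (pow_le_pow_right₀ hs.le (Nat.le_succ n))
      (mul_nonneg h.two_pos.le (h.coeff_nonneg n))
  have hsn : 0 < s ^ n := pow_pos (by linarith) n
  have htn : 0 < t ^ n := pow_pos (by linarith) n
  have hp := h.two_pos
  rw [div_pow, inv_mul_eq_div, le_div_iff₀ hp, le_div_iff₀ hsn]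
  nlinarith

/-- The coefficients do not decay exponentially fast. -/
theorem eventually_lt_coeff (h : IsCriticalProgeny φ Q) {r : ℝ} (hr : 1 < r) :
    ∀ᶠ n : ℕ in atTop, (r ^ n)⁻¹ < coeff n Q := by
  obtain ⟨s, hs1, hsr⟩ := exists_between hr
  obtain ⟨n₀, hn₀⟩ := h.exists_large_coeff hs1
  have hs0 : 0 < s := by linarith
  have hp1 := h.one_pos
  have hp2 := h.two_pos
  -- Joining copies of the good size `n₀` reaches the sizes `j (n₀ + 1) + n₀`; the extra 1 is the
  -- new root at each join.
  have hmul : ∀ j : ℕ, 1 ≤ φ.coeff 2 * coeff (j * (n₀ + 1) + n₀) Q * s ^ ((j + 1) * (n₀ + 1)) := by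
    intro j
    induction j with
    | zero => simpa using hn₀
    | succ j ih =>
      have h1 := h.coeff_two_mul_le (j * (n₀ + 1) + n₀) n₀
      have e1 : (j + 1) * (n₀ + 1) + n₀ = j * (n₀ + 1) + n₀ + n₀ + 1 := by ring
      have e2 : (j + 1 + 1) * (n₀ + 1) = (j + 1) * (n₀ + 1) + (n₀ + 1) := by ring
      rw [e1, e2, pow_add]
      have h2 := one_le_mul_of_one_le_of_one_le ih hn₀
      have h3 : 0 ≤ φ.coeff 2 * (s ^ ((j + 1) * (n₀ + 1)) * s ^ (n₀ + 1)) := by positivity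
      nlinarith [mul_le_mul_of_nonneg_left h1 h3]
  -- Adding `i` roots with a single child reaches the sizes in between; as `i ≤ n₀`, this costs only
  -- a constant factor.
  have hfill : ∀ i m : ℕ, φ.coeff 1 ^ i * coeff m Q ≤ coeff (m + i) Q := by
    intro i m
    induction i with
    | zero => simp
    | succ i ih =>
      rw [pow_succ', mul_assoc, ← add_assoc]
      exact (mul_le_mul_of_nonneg_left ih hp1.le).trans (h.coeff_one_mul_le _)
  have hp1' := h.coeff_one_lt_one
  have hlim : Tendsto (fun n : ℕ => (s / r) ^ n) atTop (𝓝 0) :=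
    tendsto_pow_atTop_nhds_zero_of_lt_one (by positivity) ((div_lt_one (by linarith)).2 hsr)
  set c : ℝ := φ.coeff 1 ^ (n₀ + 1) / (φ.coeff 2 * s ^ (n₀ + 1)) with hc
  have hc0 : 0 < c := by positivity
  filter_upwards [hlim.eventually_lt_const hc0, eventually_ge_atTop n₀] with n hn hn1
  obtain ⟨j, i, hi, rfl⟩ : ∃ j i : ℕ, i ≤ n₀ ∧ n = j * (n₀ + 1) + n₀ + i := by
    refine ⟨(n - n₀) / (n₀ + 1), (n - n₀) % (n₀ + 1),
      Nat.lt_succ_iff.1 (Nat.mod_lt _ (Nat.succ_pos _)), ?_⟩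
    have := Nat.div_add_mod (n - n₀) (n₀ + 1)
    rw [mul_comm] at this
    omega
  have h1 := hfill i (j * (n₀ + 1) + n₀)
  have h2 := hmul j
  set n := j * (n₀ + 1) + n₀ + i with hndef
  set a := coeff (j * (n₀ + 1) + n₀) Q with ha
  have ha0 : 0 ≤ a := h.coeff_nonneg _
  have h3 : φ.coeff 1 ^ (n₀ + 1) * a ≤ coeff n Q :=
    (mul_le_mul_of_nonneg_right (pow_le_pow_of_le_one hp1.le hp1'.le (by omega)) ha0).trans h1
  have h4 : s ^ ((j + 1) * (n₀ + 1)) ≤ s ^ n * s ^ (n₀ + 1) := by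
    rw [← pow_add]
    refine pow_le_pow_right₀ hs1.le ?_
    rw [hndef]
    have : (j + 1) * (n₀ + 1) = j * (n₀ + 1) + n₀ + 1 := by ring
    omega
  have h5 : 1 ≤ φ.coeff 2 * a * (s ^ n * s ^ (n₀ + 1)) :=
    h2.trans (mul_le_mul_of_nonneg_left h4 (by positivity))
  have h6 : c * (s ^ n)⁻¹ ≤ φ.coeff 1 ^ (n₀ + 1) * a := by
    rw [hc, ← div_eq_mul_inv, div_div, div_le_iff₀ (by positivity)]
    have : 0 < φ.coeff 1 ^ (n₀ + 1) := by positivity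
    nlinarith
  refine lt_of_lt_of_le ?_ (h6.trans h3)
  have hsn : 0 < s ^ n := pow_pos hs0 n
  rw [div_pow] at hn
  rw [← div_eq_mul_inv, lt_div_iff₀ hsn, ← div_eq_inv_mul]
  exact hn

/-- Summing over runs of vertices with one child rewrites `Q = x φ(Q)` as `Q = Y ψ(Q)` with `ψ = φ -
p y` and `Y = x / (1 - p x)`. So `Q` is, to any order, a polynomial in `Y` with nonnegative
coefficients. -/
theorem sq_coeff_le (h : IsCriticalProgeny φ Q) (n : ℕ) :
    (((n : ℝ) + 1) * φ.coeff 1 * coeff (n + 1) Q) ^ 2 ≤ coeff (n + 2) Q *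
      (((n : ℝ) + 1) * φ.coeff 1 * (coeff (n + 1) Q + n * φ.coeff 1 * coeff n Q)) := by
  set p := φ.coeff 1 with hp
  set ψ : Polynomial ℝ := φ - Polynomial.C p * Polynomial.X with hψ
  have hψ0 : ∀ i, 0 ≤ ψ.coeff i := by
    intro i
    rw [hψ, Polynomial.coeff_sub, Polynomial.coeff_C_mul, Polynomial.coeff_X]
    split_ifs with hi
    · subst hi
      simp [hp]
    · simpa using h.nonneg i
  have hfix : Q = geomSeries p * Polynomial.aeval Q ψ := by
    refine mul_right_cancel₀ (one_sub_C_mul_X_ne_zero p) ?_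
    rw [mul_right_comm, geomSeries_mul, hψ, map_sub, map_mul, Polynomial.aeval_X,
      Polynomial.aeval_C]
    have h1 := h.fixed
    have e : algebraMap ℝ ℝ⟦X⟧ p = C p := rfl
    rw [e]
    linear_combination h1
  -- Order `n + 3` preserves the three coefficients that occur.
  obtain ⟨R, hR, hd, -⟩ := exists_approx_of_fixed hψ0 (Dvd.intro _ rfl) hfix (n + 3)
  have h1 := sq_coeff_le_of_geomSeries h.one_pos.le hR rfl n
  rw [coeff_eq_of_X_pow_dvd_sub hd (by omega : n < n + 3),
    coeff_eq_of_X_pow_dvd_sub hd (by omega : n + 1 < n + 3),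
    coeff_eq_of_X_pow_dvd_sub hd (by omega : n + 2 < n + 3)]
  exact h1

end IsCriticalProgeny

/-! ### The ratio limit theorem -/

/-- A subexponential sequence whose ratios are almost monotone satisfies the ratio limit theorem. -/
theorem tendsto_ratio_of_subexponential {u : ℕ → ℝ} {p : ℝ} (hp : 0 < p) (hu0 : ∀ n, 0 < u n)
    (hu1 : ∀ n, u n ≤ 1) (hsub : ∀ r : ℝ, 1 < r → ∀ᶠ n : ℕ in atTop, (r ^ n)⁻¹ < u n)
    (hstep : ∀ n : ℕ, ((n + 1 : ℕ) + 1 : ℝ) * p * (u (n + 1) / u (n + 2)) ≤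
      ((n : ℝ) + 1) * p * (u n / u (n + 1)) + 1) :
    Tendsto (fun n => u n / u (n + 1)) atTop (𝓝 1) := by
  set y : ℕ → ℝ := fun n => u n / u (n + 1) with hy
  have hyu : ∀ n, u n = y n * u (n + 1) := fun n => by
    rw [hy]; field_simp [(hu0 (n + 1)).ne']
  have hsteps : ∀ j n : ℕ, ((n + j : ℕ) + 1 : ℝ) * p * y (n + j) ≤
      ((n : ℝ) + 1) * p * y n + j := by
    intro j n
    induction j with
    | zero => simp
    | succ j ih =>
      have := hstep (n + j)
      rw [← add_assoc]
      push_cast at this ih ⊢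
      change _ ≤ _ * y (n + j) + 1 at this
      change _ * y (n + j + 1) ≤ _ at this
      linarith
  -- About `δ n` factors `η < 1` are exponentially small in `n`, so by subexponentiality they end up
  -- below `u n` and `u (n + 1)`.
  have hrate : ∀ η δ : ℝ, 0 < η → η < 1 → 0 < δ →
      ∀ᶠ n : ℕ in atTop, η ^ (⌈δ * ((n : ℝ) + 1)⌉₊) < u n ∧
        η ^ (⌈δ * ((n : ℝ) + 1)⌉₊) < u (n + 1) := by
    intro η δ hη0 hη1 hδ
    have hr0 : 0 < η ^ δ := Real.rpow_pos_of_pos hη0 δ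
    have hr1 : η ^ δ < 1 := Real.rpow_lt_one hη0.le hη1 hδ
    have h1 := hsub (η ^ δ)⁻¹ ((one_lt_inv₀ hr0).2 hr1)
    have hle : ∀ n : ℕ, η ^ (⌈δ * ((n : ℝ) + 1)⌉₊) ≤ (η ^ δ) ^ (n + 1) := by
      intro n
      rw [← Real.rpow_natCast, ← Real.rpow_natCast (η ^ δ), ← Real.rpow_mul hη0.le]
      refine Real.rpow_le_rpow_of_exponent_ge hη0 hη1.le ?_
      push_cast
      exact Nat.le_ceil _
    filter_upwards [h1, (tendsto_add_atTop_nat 1).eventually h1] with n hn hn'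
    rw [inv_pow, inv_inv] at hn hn'
    refine ⟨?_, (hle n).trans_lt hn'⟩
    refine lt_of_le_of_lt ((hle n).trans ?_) hn
    exact pow_le_pow_of_le_one hr0.le hr1.le (Nat.le_succ n)
  refine tendsto_order.2 ⟨fun a ha => ?_, fun b hb => ?_⟩
  · obtain ⟨ε, hε0, hε1, hεa⟩ : ∃ ε : ℝ, 0 < ε ∧ ε < 1 ∧ a ≤ 1 - ε := by
      refine ⟨min (1 - a) (1 / 2), lt_min (by linarith) (by norm_num),
        (min_le_right _ _).trans_lt (by norm_num), ?_⟩
      linarith [min_le_left (1 - a) (1 / 2)]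
    -- A ratio `y n ≤ 1 - ε` would stay below `1 - ε / 2` for the next `p ε n / 2` steps, since
    -- `hsteps` limits the growth. Then `u n` would be exponentially small.
    have hδ : 0 < p * ε / 2 := by positivity
    filter_upwards [hrate (1 - ε / 2) (p * ε / 2) (by linarith) (by linarith) hδ] with n hn
    by_contra! hcon
    have hcon' : y n ≤ 1 - ε := hcon.trans hεa
    have key : ∀ j ≤ ⌈p * ε / 2 * ((n : ℝ) + 1)⌉₊, u n ≤ (1 - ε / 2) ^ j * u (n + j) := by
      intro j hj
      induction j with
      | zero => simp
      | succ j ih =>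
        have hj' : (j : ℝ) < p * ε / 2 * ((n : ℝ) + 1) := Nat.lt_ceil.1 hj
        have h1 := hsteps j n
        have h2 : y (n + j) ≤ 1 - ε / 2 := by
          have hpos : 0 < ((n + j : ℕ) + 1 : ℝ) * p := by positivity
          refine le_of_mul_le_mul_left ?_ hpos
          refine h1.trans ?_
          have h3 : ((n : ℝ) + 1) * p * y n ≤ ((n : ℝ) + 1) * p * (1 - ε) :=
            mul_le_mul_of_nonneg_left hcon' (by positivity)
          have h4 : 0 ≤ (j : ℝ) * p * (1 - ε / 2) :=
            mul_nonneg (by positivity) (by linarith)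
          push_cast
          nlinarith
        have h3 : u (n + j) ≤ (1 - ε / 2) * u (n + j + 1) := by
          rw [hyu (n + j)]
          exact mul_le_mul_of_nonneg_right h2 (hu0 _).le
        calc u n ≤ (1 - ε / 2) ^ j * u (n + j) := ih (by omega)
          _ ≤ (1 - ε / 2) ^ j * ((1 - ε / 2) * u (n + j + 1)) :=
            mul_le_mul_of_nonneg_left h3 (pow_nonneg (by linarith) _)
          _ = (1 - ε / 2) ^ (j + 1) * u (n + (j + 1)) := by rw [pow_succ, add_assoc]; ring
    have h1 := key _ le_rfl
    have h2 := mul_le_mul_of_nonneg_left (hu1 (n + ⌈p * ε / 2 * ((n : ℝ) + 1)⌉₊))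
      (pow_nonneg (by linarith : (0 : ℝ) ≤ 1 - ε / 2) ⌈p * ε / 2 * ((n : ℝ) + 1)⌉₊)
    rw [mul_one] at h2
    linarith [hn.1]
  · set ε := b - 1 with hε
    have hε0 : 0 < ε := by linarith
    -- A ratio `y n ≥ 1 + ε` must have been at least `1 + ε / 2` during the preceding `δ n` steps,
    -- which makes `u (n + 1)` exponentially small. The bound `1 / 2` keeps the backward walk at
    -- positive indices.
    set δ := min (p * ε / 2) (1 / 2) with hδdef
    have hδ : 0 < δ := lt_min (by positivity) (by norm_num)
    have hη1 : (1 + ε / 2)⁻¹ < 1 := inv_lt_one_of_one_lt₀ (by linarith)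
    filter_upwards [hrate (1 + ε / 2)⁻¹ δ (by positivity) hη1 hδ] with n hn
    by_contra! hcon
    have hcon' : 1 + ε ≤ y n := by rw [hε]; linarith
    have key : ∀ j ≤ ⌈δ * ((n : ℝ) + 1)⌉₊, ∃ k, k + j = n + 1 ∧
        u (n + 1) ≤ ((1 + ε / 2)⁻¹) ^ j * u k := by
      intro j hj
      induction j with
      | zero => exact ⟨n + 1, rfl, by simp⟩
      | succ j ih =>
        obtain ⟨k, hk, hle⟩ := ih (by omega)
        have hj' : (j : ℝ) < δ * ((n : ℝ) + 1) := Nat.lt_ceil.1 hj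
        have hj1 : (j : ℝ) < p * ε / 2 * ((n : ℝ) + 1) :=
          hj'.trans_le (mul_le_mul_of_nonneg_right (min_le_left _ _) (by positivity))
        have hj2 : (j : ℝ) < 1 / 2 * ((n : ℝ) + 1) :=
          hj'.trans_le (mul_le_mul_of_nonneg_right (min_le_right _ _) (by positivity))
        have hkR : (k : ℝ) + j = n + 1 := by exact_mod_cast hk
        have hk0 : 0 < k := by
          have : (0 : ℝ) < k := by
            have : (0 : ℝ) ≤ n := n.cast_nonneg
            linarith
          exact_mod_cast this
        obtain ⟨l, rfl⟩ : ∃ l, k = l + 1 := ⟨k - 1, by omega⟩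
        refine ⟨l, by omega, ?_⟩
        have hn' : l + j = n := by omega
        have h1 := hsteps j l
        rw [hn'] at h1
        have hlR : (l : ℝ) + j = n := by exact_mod_cast hn'
        have h2 : 1 + ε / 2 ≤ y l := by
          have hpos : 0 < ((l : ℝ) + 1) * p := by positivity
          refine le_of_mul_le_mul_left ?_ hpos
          have h3 : ((n : ℝ) + 1) * p * (1 + ε) ≤ ((n : ℝ) + 1) * p * y n :=
            mul_le_mul_of_nonneg_left hcon' (by positivity)
          have h4 : ((l : ℝ) + 1) * p * (1 + ε / 2) ≤ ((n : ℝ) + 1) * p * (1 + ε / 2) := by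
            refine mul_le_mul_of_nonneg_right (mul_le_mul_of_nonneg_right ?_ hp.le) (by linarith)
            have : (0 : ℝ) ≤ j := j.cast_nonneg
            linarith
          nlinarith
        have h3 : u (l + 1) ≤ (1 + ε / 2)⁻¹ * u l := by
          rw [hyu l, ← div_eq_inv_mul, le_div_iff₀ (by positivity), mul_comm]
          exact mul_le_mul_of_nonneg_right h2 (hu0 _).le
        calc u (n + 1) ≤ ((1 + ε / 2)⁻¹) ^ j * u (l + 1) := hle
          _ ≤ ((1 + ε / 2)⁻¹) ^ j * ((1 + ε / 2)⁻¹ * u l) :=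
            mul_le_mul_of_nonneg_left h3 (by positivity)
          _ = ((1 + ε / 2)⁻¹) ^ (j + 1) * u l := by rw [pow_succ]; ring
    obtain ⟨k, -, h1⟩ := key _ le_rfl
    have h2 := mul_le_mul_of_nonneg_left (hu1 k)
      (by positivity : 0 ≤ ((1 + ε / 2)⁻¹) ^ ⌈δ * ((n : ℝ) + 1)⌉₊)
    rw [mul_one] at h2
    linarith [hn.2]

/-! ### Asymptotic lower bounds and convolutions -/

/-- `f` is asymptotically at least `a * q`. -/
def AsympGE (q f : ℕ → ℝ) (a : ℝ) : Prop := ∀ c < a, ∀ᶠ n in atTop, c * q n ≤ f n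

namespace AsympGE

variable {q f g : ℕ → ℝ} {a b : ℝ}

theorem add (hf : AsympGE q f a) (hg : AsympGE q g b) :
    AsympGE q (fun n => f n + g n) (a + b) := by
  intro c hc
  filter_upwards [hf (a - (a + b - c) / 2) (by linarith), hg (b - (a + b - c) / 2) (by linarith)]
    with n h1 h2
  have : c * q n = (a - (a + b - c) / 2) * q n + (b - (a + b - c) / 2) * q n := by ring
  linarith

theorem zero (hq : ∀ n, 0 ≤ q n) (hf : ∀ n, 0 ≤ f n) : AsympGE q f 0 := fun _ hc =>
  Eventually.of_forall fun n => (mul_nonpos_of_nonpos_of_nonneg hc.le (hq n)).trans (hf n)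

theorem const_mul (hq : ∀ n, 0 ≤ q n) {k : ℝ} (hk : 0 ≤ k) (hf : AsympGE q f a) :
    AsympGE q (fun n => k * f n) (k * a) := by
  rcases hk.eq_or_lt with rfl | hk
  · simp only [zero_mul]
    exact zero hq fun _ => le_rfl
  · intro c hc
    filter_upwards [hf (c / k) (by rwa [div_lt_iff₀ hk, mul_comm])] with n hn
    have := mul_le_mul_of_nonneg_left hn hk.le
    rwa [← mul_assoc, mul_div_cancel₀ _ hk.ne'] at this

theorem mono (hf : AsympGE q f a) (hfg : ∀ᶠ n in atTop, f n ≤ g n) : AsympGE q g a := by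
  intro c hc
  filter_upwards [hf c hc, hfg] with n h1 h2
  exact h1.trans h2

theorem sum {ι : Type*} (hq : ∀ n, 0 ≤ q n) (s : Finset ι) {F : ι → ℕ → ℝ} {A : ι → ℝ}
    (h : ∀ i ∈ s, AsympGE q (F i) (A i)) :
    AsympGE q (fun n => ∑ i ∈ s, F i n) (∑ i ∈ s, A i) := by
  classical
  induction s using Finset.induction_on with
  | empty => simpa using zero hq (f := fun _ => 0) fun _ => le_rfl
  | insert i s hi ih =>
    simp only [Finset.sum_insert hi]
    exact (h i (by simp)).add (ih fun j hj => h j (by simp [hj]))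

theorem shift_one (hq : ∀ n, 0 < q (n + 1))
    (hratio : Tendsto (fun n => q n / q (n + 1)) atTop (𝓝 1)) (hf : AsympGE q f a) :
    AsympGE q (fun n => f (n - 1)) a := by
  intro c hc
  obtain ⟨c', hcc', hc'⟩ := exists_between hc
  have h1 : Tendsto (fun n => c' * (q n / q (n + 1))) atTop (𝓝 (c' * 1)) := hratio.const_mul c'
  rw [mul_one] at h1
  have h2 : ∀ᶠ n in atTop, c * q (n + 1) ≤ f n := by
    filter_upwards [h1.eventually_const_lt hcc', hf c' hc'] with n hn hn'
    rw [← mul_div_assoc, lt_div_iff₀ (hq n)] at hn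
    exact hn.le.trans hn'
  filter_upwards [(tendsto_sub_atTop_nat 1).eventually h2, eventually_ge_atTop 1] with n hn hn1
  rwa [Nat.sub_add_cancel hn1] at hn

theorem shift (hq : ∀ n, 0 < q (n + 1))
    (hratio : Tendsto (fun n => q n / q (n + 1)) atTop (𝓝 1)) (hf : AsympGE q f a) (j : ℕ) :
    AsympGE q (fun n => f (n - j)) a := by
  induction j with
  | zero => exact hf
  | succ j ih => exact (shift_one hq hratio ih).mono (Eventually.of_forall fun n => by
      rw [Nat.sub_sub, add_comm])

theorem tendsto_div (hq : ∀ n, 0 < q (n + 1)) (h1 : AsympGE q f a)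
    (h2 : AsympGE q (fun n => -f n) (-a)) : Tendsto (fun n => f n / q n) atTop (𝓝 a) := by
  have hpos : ∀ᶠ n in atTop, 0 < q n := by
    filter_upwards [eventually_ge_atTop 1] with n hn
    have := hq (n - 1)
    rwa [Nat.sub_add_cancel hn] at this
  refine tendsto_order.2 ⟨fun c hc => ?_, fun c hc => ?_⟩
  · obtain ⟨c', hcc', hc'⟩ := exists_between hc
    filter_upwards [h1 c' hc', hpos] with n hn hn'
    exact hcc'.trans_le ((le_div_iff₀ hn').2 hn)
  · obtain ⟨c', hc', hcc'⟩ := exists_between hc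
    filter_upwards [h2 (-c') (by linarith), hpos] with n hn hn'
    exact lt_of_le_of_lt ((div_le_iff₀ hn').2 (by linarith)) hcc'

open PowerSeries in
-- In the convolution only the terms with one index below a fixed `J` are kept. For `n ≥ 2 J` the
-- two end blocks are disjoint; the ratio limit replaces `q (n - j)` by `q n`, and then `J → ∞`.
-- Nonnegativity permits discarding the middle, so only lower bounds come out.
theorem coeff_mul {f g : ℝ⟦X⟧} {A B : ℝ} (hq : ∀ n, 0 < q (n + 1)) (hq0 : ∀ n, 0 ≤ q n)
    (hratio : Tendsto (fun n => q n / q (n + 1)) atTop (𝓝 1))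
    (hf0 : ∀ n, 0 ≤ coeff n f) (hg0 : ∀ n, 0 ≤ coeff n g)
    (hfA : HasSum (fun n => coeff n f) A) (hgB : HasSum (fun n => coeff n g) B)
    (hf : AsympGE q (fun n => coeff n f) a) (hg : AsympGE q (fun n => coeff n g) b) :
    AsympGE q (fun n => coeff n (f * g)) (A * b + B * a) := by
  have hJ : ∀ J : ℕ, AsympGE q (fun n => coeff n (f * g))
      (∑ j ∈ Finset.range J, coeff j f * b + ∑ j ∈ Finset.range J, coeff j g * a) := by
    intro J
    have h1 := (sum hq0 (Finset.range J) fun j _ =>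
      const_mul hq0 (hf0 j) (shift hq hratio hg j)).add (sum hq0 (Finset.range J) fun j _ =>
      const_mul hq0 (hg0 j) (shift hq hratio hf j))
    refine h1.mono ?_
    filter_upwards [eventually_ge_atTop (2 * J)] with n hn
    rw [PowerSeries.coeff_mul]
    have hinj1 : Set.InjOn (fun j : ℕ => (j, n - j)) (Finset.range J) := fun i _ j _ hij =>
      (Prod.ext_iff.1 hij).1
    have hinj2 : Set.InjOn (fun j : ℕ => (n - j, j)) (Finset.range J) := fun i _ j _ hij =>
      (Prod.ext_iff.1 hij).2
    have hdisj : Disjoint ((Finset.range J).image fun j : ℕ => (j, n - j))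
        ((Finset.range J).image fun j : ℕ => (n - j, j)) := by
      rw [Finset.disjoint_left]
      rintro x hx hx'
      simp only [Finset.mem_image, Finset.mem_range] at hx hx'
      obtain ⟨i, hi, rfl⟩ := hx
      obtain ⟨j, hj, hij⟩ := hx'
      have := (Prod.ext_iff.1 hij).1
      simp only at this
      omega
    have hsub : ((Finset.range J).image fun j : ℕ => (j, n - j)) ∪
        ((Finset.range J).image fun j : ℕ => (n - j, j)) ⊆ Finset.HasAntidiagonal.antidiagonal n := by
      intro x hx
      simp only [Finset.mem_union, Finset.mem_image, Finset.mem_range] at hx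
      rw [Finset.HasAntidiagonal.mem_antidiagonal]
      rcases hx with ⟨j, hj, rfl⟩ | ⟨j, hj, rfl⟩ <;> simp only <;> omega
    have h2 := Finset.sum_le_sum_of_subset_of_nonneg hsub
      (f := fun x : ℕ × ℕ => coeff x.1 f * coeff x.2 g)
      fun x _ _ => mul_nonneg (hf0 _) (hg0 _)
    rw [Finset.sum_union hdisj, Finset.sum_image hinj1, Finset.sum_image hinj2] at h2
    refine le_trans (le_of_eq ?_) h2
    congr 1
    exact Finset.sum_congr rfl fun j _ => mul_comm _ _
  intro c hc
  have hlim : Tendsto (fun J => ∑ j ∈ Finset.range J, coeff j f * b +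
      ∑ j ∈ Finset.range J, coeff j g * a) atTop (𝓝 (A * b + B * a)) :=
    (hfA.mul_right b).tendsto_sum_nat.add (hgB.mul_right a).tendsto_sum_nat
  obtain ⟨J, hJc⟩ := (hlim.eventually_const_lt hc).exists
  exact hJ J c hJc

end AsympGE

/-! ### Coefficients of the powers of the progeny series -/

namespace IsCriticalProgeny

open PowerSeries

variable {φ : Polynomial ℝ} {Q : ℝ⟦X⟧}

theorem tendsto_ratio (h : IsCriticalProgeny φ Q) :
    Tendsto (fun n => coeff n Q / coeff (n + 1) Q) atTop (𝓝 1) := by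
  -- The constant coefficient of `Q` vanishes, so the positive sequence starts at index 1.
  rw [← tendsto_add_atTop_iff_nat 1]
  refine tendsto_ratio_of_subexponential (u := fun n => coeff (n + 1) Q) h.one_pos h.pos
    (fun n => h.coeff_le_one _) (fun r hr => ?_) fun n => ?_
  -- Using the rate `√r` absorbs the index shift: `√r ^ (n + 1) ≤ r ^ n` for `n ≥ 1`.
  · filter_upwards [(tendsto_add_atTop_nat 1).eventually
      (h.eventually_lt_coeff (r := Real.sqrt r) (Real.lt_sqrt_of_sq_lt (by simpa using hr))),
      eventually_ge_atTop 1] with n hn hn1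
    refine lt_of_le_of_lt ?_ hn
    have hs : 1 ≤ Real.sqrt r := Real.one_le_sqrt.2 hr.le
    refine inv_anti₀ (by positivity) ?_
    calc Real.sqrt r ^ (n + 1) ≤ Real.sqrt r ^ (2 * n) := pow_le_pow_right₀ hs (by omega)
      _ = r ^ n := by rw [pow_mul, Real.sq_sqrt (by linarith)]
  · have h1 := h.sq_coeff_le (n + 1)
    have p0 := h.one_pos
    have u0 := h.pos n
    have u1 := h.pos (n + 1)
    have u2 := h.pos (n + 2)
    simp only [add_assoc, Nat.reduceAdd] at *
    set A := coeff (n + 1) Q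
    set B := coeff (n + 2) Q
    set D := coeff (n + 3) Q
    set p := φ.coeff 1
    rw [← mul_div_assoc, ← mul_div_assoc, div_add_one u1.ne', div_le_div_iff₀ u2 u1]
    push_cast at h1 ⊢
    have hpos : 0 < ((n : ℝ) + (1 + 1)) * p := by positivity
    refine le_of_mul_le_mul_left ?_ hpos
    nlinarith [h1]

theorem asympGE_pow (h : IsCriticalProgeny φ Q) (k : ℕ) :
    AsympGE (fun n => coeff n Q) (fun n => coeff n (Q ^ k)) k := by
  induction k with
  | zero =>
    simpa using AsympGE.zero h.coeff_nonneg (coeff_pow_nonneg h.coeff_nonneg 0)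
  | succ k ih =>
    have h1 : AsympGE (fun n => coeff n Q) (fun n => coeff n Q) 1 := fun c hc =>
      Eventually.of_forall fun n => by nlinarith [h.coeff_nonneg n]
    have := AsympGE.coeff_mul h.pos h.coeff_nonneg h.tendsto_ratio
      (coeff_pow_nonneg h.coeff_nonneg k) h.coeff_nonneg (hasSum_coeff_pow h.hasSum k) h.hasSum
      ih h1
    rw [← pow_succ] at this
    simpa [add_comm] using this

/-- In `q_{n+1} = ∑ φ_k [x^n] Q^k` each term is asymptotically at least `k φ_k q_n`, while `∑ k φ_k
= 1` and `q_{n+1} ~ q_n`. No term can exceed its bound, and `φ_2 > 0` isolates `k = 2`. -/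
theorem asympGE_neg_sq (h : IsCriticalProgeny φ Q) :
    AsympGE (fun n => coeff n Q) (fun n => -coeff n (Q ^ 2)) (-2) := by
  have h1 : AsympGE (fun n => coeff n Q) (fun n => -coeff (n + 1) Q) (-1) := by
    intro c hc
    have h2 : Tendsto (fun n => c * (coeff n Q / coeff (n + 1) Q)) atTop (𝓝 (c * 1)) :=
      h.tendsto_ratio.const_mul c
    rw [mul_one] at h2
    filter_upwards [h2.eventually_lt_const hc] with n hn
    rw [← mul_div_assoc, div_lt_iff₀ (h.pos n)] at hn
    linarith
  have h2 := AsympGE.sum h.coeff_nonneg ((Finset.range (φ.natDegree + 1)).erase 2) fun k _ =>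
    AsympGE.const_mul h.coeff_nonneg (h.nonneg k) (h.asympGE_pow k)
  have h3 := AsympGE.const_mul h.coeff_nonneg (inv_nonneg.2 h.two_pos.le) (h1.add h2)
  have hs : ∑ k ∈ (Finset.range (φ.natDegree + 1)).erase 2, φ.coeff k * (k : ℝ) =
      1 - φ.coeff 2 * 2 := by
    have := Finset.add_sum_erase _ (fun k : ℕ => φ.coeff k * (k : ℝ)) h.two_mem
    rw [h.sum_coeff_mul] at this
    push_cast at this
    linarith
  have hp2 := h.two_pos.ne'
  have e : (φ.coeff 2)⁻¹ * (-1 + ∑ k ∈ (Finset.range (φ.natDegree + 1)).erase 2,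
      φ.coeff k * (k : ℝ)) = -2 := by
    rw [hs]
    field_simp
    ring
  rw [e] at h3
  refine h3.mono (Eventually.of_forall fun n => le_of_eq ?_)
  have := Finset.add_sum_erase _ (fun k : ℕ => φ.coeff k * coeff n (Q ^ k)) h.two_mem
  rw [← h.coeff_succ] at this
  rw [← this]
  field_simp
  ring

/-- For `c` large, `g = c Q - Q^{k+1}` has nonnegative coefficients, so the lower bound for products
applies to `g Q = c Q² - Q^{k+2}`. With the upper bound for `Q²` it becomes an upper bound for
`Q^{k+2}`. -/
theorem asympGE_neg_pow (h : IsCriticalProgeny φ Q) (k : ℕ) :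
    AsympGE (fun n => coeff n Q) (fun n => -coeff n (Q ^ k)) (-k) := by
  have hself : AsympGE (fun n => coeff n Q) (fun n => coeff n Q) 1 := fun c hc =>
      Eventually.of_forall fun n => by nlinarith [h.coeff_nonneg n]
  rcases k with _ | k
  · intro c hc
    filter_upwards [eventually_ge_atTop 1] with n hn
    have : coeff n (Q ^ 0) = 0 := by rw [pow_zero, coeff_one, if_neg (by omega)]
    rw [this]
    simp only [CharP.cast_eq_zero, neg_zero] at hc ⊢
    exact mul_nonpos_of_nonpos_of_nonneg hc.le (h.coeff_nonneg n)
  induction k with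
  | zero =>
    intro c hc
    refine Eventually.of_forall fun n => ?_
    simp only [zero_add, pow_one, Nat.cast_one] at hc ⊢
    nlinarith [h.coeff_nonneg n]
  | succ k ih =>
    have htend := AsympGE.tendsto_div h.pos (h.asympGE_pow (k + 1)) ih
    -- The quotients `[x^n] Q^{k+1} / q_n` converge by the induction hypothesis, hence are bounded;
    -- this provides `c`.
    obtain ⟨c₀, hc₀⟩ := htend.bddAbove_range
    set c := max c₀ ((k : ℝ) + 1) with hc
    have hck : (k : ℝ) + 1 ≤ c := le_max_right _ _
    have hc0 : 0 ≤ c := le_trans (by positivity) hck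
    have hbound : ∀ n, coeff n (Q ^ (k + 1)) ≤ c * coeff n Q := by
      intro n
      cases n with
      | zero =>
        rw [h.coeff_zero, mul_zero, pow_succ', h.fixed, mul_assoc, coeff_zero_X_mul]
      | succ n =>
        rw [← div_le_iff₀ (h.pos n)]
        exact (hc₀ ⟨n + 1, rfl⟩).trans (le_max_left _ _)
    set g : ℝ⟦X⟧ := C c * Q - Q ^ (k + 1) with hg
    have hgc : ∀ n, coeff n g = c * coeff n Q + -coeff n (Q ^ (k + 1)) := fun n => by
      rw [hg, map_sub, coeff_C_mul, sub_eq_add_neg]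
    have hg0 : ∀ n, 0 ≤ coeff n g := fun n => by rw [hgc]; linarith [hbound n]
    have hgS : HasSum (fun n => coeff n g) (c * 1 + -1 ^ (k + 1)) := by
      simp only [hgc]
      exact (h.hasSum.mul_left c).add (hasSum_coeff_pow h.hasSum (k + 1)).neg
    have hgA : AsympGE (fun n => coeff n Q) (fun n => coeff n g) (c * 1 + -((k + 1 : ℕ) : ℝ)) := by
      simp only [hgc]
      exact (AsympGE.const_mul h.coeff_nonneg hc0 hself).add ih
    have hgQ := AsympGE.coeff_mul h.pos h.coeff_nonneg h.tendsto_ratio hg0 h.coeff_nonneg hgS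
      h.hasSum hgA hself
    have h4 := hgQ.add (AsympGE.const_mul h.coeff_nonneg hc0 h.asympGE_neg_sq)
    have e : (c * 1 + -1 ^ (k + 1)) * 1 + 1 * (c * 1 + -((k + 1 : ℕ) : ℝ)) + c * -2 =
        -((k + 1 + 1 : ℕ) : ℝ) := by
      rw [one_pow]
      push_cast
      ring
    rw [e] at h4
    refine h4.mono (Eventually.of_forall fun n => le_of_eq ?_)
    have : g * Q = C c * Q ^ 2 - Q ^ (k + 1 + 1) := by rw [hg]; ring
    rw [this, map_sub, coeff_C_mul]
    ring

/-- The total progeny of `k` ancestors is, up to the factor `k`, as likely to be large as the one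
of a single ancestor. -/
theorem tendsto_coeff_pow_div (h : IsCriticalProgeny φ Q) (k m : ℕ) :
    Tendsto (fun n => coeff (n - m) (Q ^ k) / coeff n Q) atTop (𝓝 k) :=
  AsympGE.tendsto_div h.pos ((h.asympGE_pow k).shift h.pos h.tendsto_ratio m)
    ((h.asympGE_neg_pow k).shift h.pos h.tendsto_ratio m)

end IsCriticalProgeny

/-! ### Decomposition of a tree at its root -/

namespace PlaneTree

variable {D : ℕ}

open Classical in
theorem val_deg (T : PlaneTree D) (v : List (Fin D)) :
    (T.deg v : ℕ) = (Finset.univ.filter fun i => v ++ [i] ∈ T.verts).card := by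
  have h : (Finset.univ.filter fun i => v ++ [i] ∈ T.verts) =
      ((List.finRange D).filter fun i => v ++ [i] ∈ T.verts).toFinset := by
    ext i
    simp
  rw [h, List.toFinset_card_of_nodup ((List.nodup_finRange D).filter _)]
  simp [deg, children]

theorem append_singleton_mem_iff (T : PlaneTree D) (v : List (Fin D)) (i : Fin D) :
    v ++ [i] ∈ T.verts ↔ (i : ℕ) < T.deg v := by
  classical
  rw [val_deg]
  constructor
  · intro h
    have hs : Finset.Iic i ⊆ Finset.univ.filter fun i => v ++ [i] ∈ T.verts := fun j hj => by
      simpa using T.sibling_mem v i j (Finset.mem_Iic.1 hj) h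
    have := Finset.card_le_card hs
    rw [Fin.card_Iic] at this
    omega
  · intro h
    by_contra hi
    have hs : (Finset.univ.filter fun i => v ++ [i] ∈ T.verts) ⊆ Finset.Iio i := fun j hj => by
      rw [Finset.mem_Iio]
      by_contra hij
      exact hi (T.sibling_mem v j i (not_lt.1 hij) (by simpa using hj))
    have := Finset.card_le_card hs
    rw [Fin.card_Iio] at this
    omega

theorem deg_eq_deg {T T' : PlaneTree D} {v v' : List (Fin D)}
    (h : ∀ i, v ++ [i] ∈ T.verts ↔ v' ++ [i] ∈ T'.verts) : T.deg v = T'.deg v' := by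
  classical
  ext
  rw [val_deg, val_deg]
  congr 1
  ext i
  simp [h i]

/-- The tree whose root has the branches `f 0, …, f (d - 1)`. -/
def node (d : Fin (D + 1)) (f : Fin d → PlaneTree D) : PlaneTree D where
  verts := {v | ∀ i u, v = i :: u → ∃ h : (i : ℕ) < d, u ∈ (f ⟨i, h⟩).verts}
  root_mem := fun i u h => by simp at h
  parent_mem := by
    rintro v i h j u rfl
    obtain ⟨hj, hu⟩ := h j (u ++ [i]) rfl
    exact ⟨hj, (f ⟨j, hj⟩).parent_mem u i hu⟩
  sibling_mem := by
    rintro v i j hij h k u hk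
    cases v with
    | nil =>
      obtain ⟨hi, -⟩ := h i [] rfl
      simp only [List.nil_append, List.cons.injEq] at hk
      obtain ⟨rfl, rfl⟩ := hk
      exact ⟨lt_of_le_of_lt hij hi, (f _).root_mem⟩
    | cons a v =>
      obtain ⟨ha, hv⟩ := h a (v ++ [i]) rfl
      simp only [List.cons_append, List.cons.injEq] at hk
      obtain ⟨rfl, rfl⟩ := hk
      exact ⟨ha, (f _).sibling_mem v i j hij hv⟩

variable {d : Fin (D + 1)}

theorem cons_mem_node (f : Fin d → PlaneTree D) (i : Fin D) (u : List (Fin D)) :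
    i :: u ∈ (node d f).verts ↔ ∃ h : (i : ℕ) < d, u ∈ (f ⟨i, h⟩).verts :=
  ⟨fun h => h i u rfl, fun h j w hj => by
    simp only [List.cons.injEq] at hj
    obtain ⟨rfl, rfl⟩ := hj
    exact h⟩

/-- The embedding of the indices of the branches of a tree into the alphabet. -/
def letter (i : Fin d) : Fin D := i.castLE (Nat.lt_succ_iff.1 d.2)

theorem letter_injective : Function.Injective (letter : Fin d → Fin D) :=
  Fin.castLE_injective (Nat.lt_succ_iff.1 d.2)

theorem letter_cons_mem_node (f : Fin d → PlaneTree D) (i : Fin d) (u : List (Fin D)) :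
    letter i :: u ∈ (node d f).verts ↔ u ∈ (f i).verts := by
  rw [cons_mem_node]
  exact ⟨fun h => h.2, fun h => ⟨i.2, h⟩⟩

theorem node_injective : Function.Injective (node d : (Fin d → PlaneTree D) → PlaneTree D) := by
  intro f g h
  funext i
  ext u
  rw [← letter_cons_mem_node f i u, h, letter_cons_mem_node]

theorem deg_node_nil (f : Fin d → PlaneTree D) : (node d f).deg [] = d := by
  have h : ∀ i : Fin D, (i : ℕ) < (node d f).deg [] ↔ (i : ℕ) < d := by
    intro i
    rw [← append_singleton_mem_iff, List.nil_append, cons_mem_node]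
    exact ⟨fun h => h.1, fun h => ⟨h, (f _).root_mem⟩⟩
  ext
  rcases lt_trichotomy ((node d f).deg [] : ℕ) d with hlt | heq | hlt
  · have := (h ⟨_, hlt.trans_le (Nat.lt_succ_iff.1 d.2)⟩).2 hlt
    simp at this
  · exact heq
  · have := (h ⟨_, hlt.trans_le (Nat.lt_succ_iff.1 ((node d f).deg []).2)⟩).1 hlt
    simp at this

theorem deg_node_cons (f : Fin d → PlaneTree D) (i : Fin d) (u : List (Fin D)) :
    (node d f).deg (letter i :: u) = (f i).deg u :=
  deg_eq_deg fun j => by rw [List.cons_append, letter_cons_mem_node]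

theorem exists_eq_node (T : PlaneTree D) : ∃ f : Fin (T.deg []) → PlaneTree D,
    T = node (T.deg []) f := by
  have h : ∀ i : Fin (T.deg []), [letter i] ∈ T.verts := fun i =>
    (T.append_singleton_mem_iff [] (letter i)).2 i.2
  refine ⟨fun i => ⟨{u | letter i :: u ∈ T.verts}, h i, fun v j hv => ?_, fun v j k hjk hv => ?_⟩,
    ?_⟩
  · exact T.parent_mem (letter i :: v) j hv
  · exact T.sibling_mem (letter i :: v) j k hjk hv
  · ext v
    cases v with
    | nil => exact iff_of_true T.root_mem (root_mem _)
    | cons j u =>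
      rw [cons_mem_node]
      refine ⟨fun hj => ⟨?_, hj⟩, fun ⟨_, hu⟩ => hu⟩
      rw [← append_singleton_mem_iff]
      have := T.take_mem hj 1
      simpa using this

theorem trunc_zero (T T' : PlaneTree D) : trunc 0 T = trunc 0 T' := by
  ext v
  simp only [trunc, Nat.le_zero, List.length_eq_zero_iff, Set.mem_ofPred_eq]
  constructor <;> rintro ⟨-, rfl⟩ <;> exact ⟨root_mem _, rfl⟩

theorem trunc_succ_node (n : ℕ) (f : Fin d → PlaneTree D) :
    trunc (n + 1) (node d f) = node d fun i => trunc n (f i) := by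
  ext v
  cases v with
  | nil => exact iff_of_true (root_mem _) (root_mem _)
  | cons i u =>
    change (i :: u ∈ (node d f).verts ∧ _) ↔ _
    rw [cons_mem_node, cons_mem_node]
    simp only [List.length_cons, add_le_add_iff_right, trunc, Set.mem_ofPred_eq]
    exact ⟨fun ⟨⟨h, hu⟩, hn⟩ => ⟨h, hu, hn⟩, fun ⟨h, hu, hn⟩ => ⟨⟨h, hu⟩, hn⟩⟩

/-- The common root recursion behind the vertex counts, the energy and their truncated versions. -/
theorem finsum_insert_nil_iUnion {M : Type*} [AddCommMonoid M] (S : Set (List (Fin D)))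
    (B : Fin d → Set (List (Fin D))) (hB : ∀ i, (B i).Finite) (hnil : [] ∈ S)
    (hcons : ∀ i u, i :: u ∈ S ↔ ∃ h : (i : ℕ) < d, u ∈ B ⟨i, h⟩) (g : List (Fin D) → M) :
    ∑ᶠ v ∈ S, g v = g [] + ∑ i, ∑ᶠ u ∈ B i, g (letter i :: u) := by
  have hS : S = insert [] (⋃ i, (fun u => letter i :: u) '' B i) := by
    ext v
    cases v with
    | nil => simpa using hnil
    | cons i u =>
      rw [hcons]
      simp only [Set.mem_insert_iff, reduceCtorEq, Set.mem_iUnion, Set.mem_image, List.cons.injEq,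
        false_or]
      constructor
      · rintro ⟨h, hu⟩
        exact ⟨⟨i, h⟩, u, hu, rfl, rfl⟩
      · rintro ⟨i, u, hu, rfl, rfl⟩
        exact ⟨i.2, hu⟩
  have hfin : ∀ i, ((fun u => letter i :: u) '' B i).Finite := fun i => (hB i).image _
  rw [hS, finsum_mem_insert _ (by simp) (Set.finite_iUnion hfin), finsum_mem_iUnion ?_ hfin,
    finsum_eq_sum_of_fintype]
  · congr 1
    refine Finset.sum_congr rfl fun i _ => ?_
    exact finsum_mem_image fun u _ w _ h => by simpa using h
  · intro i j hij
    rw [Function.onFun, Set.disjoint_left]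
    rintro _ ⟨u, -, rfl⟩ ⟨w, -, h⟩
    simp only [List.cons.injEq] at h
    exact hij (letter_injective h.1.symm)

theorem finite_length_le (n : ℕ) (S : Set (List (Fin D))) (hS : ∀ v ∈ S, v.length ≤ n) :
    S.Finite :=
  (List.finite_length_le (Fin D) n).subset hS

theorem mem_ofOrder_iff (T : PlaneTree D) (N : ℕ) :
    T ∈ ofOrder D N ↔ T.verts.Finite ∧ T.verts.ncard = N := by
  constructor
  · intro h
    have hf : T.verts.Finite := Set.finite_of_encard_eq_coe h
    refine ⟨hf, ?_⟩
    have h' : T.verts.encard = N := h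
    rw [← hf.cast_ncard_eq] at h'
    exact_mod_cast h'
  · rintro ⟨hf, rfl⟩
    exact hf.cast_ncard_eq.symm

theorem finite_node_iff (f : Fin d → PlaneTree D) :
    (node d f).verts.Finite ↔ ∀ i, (f i).verts.Finite := by
  constructor
  · intro h i
    refine (h.preimage (f := fun u => letter i :: u)
      (fun u _ w _ h => by simpa using h)).subset fun u hu => ?_
    exact (letter_cons_mem_node f i u).2 hu
  · intro h
    refine ((Set.finite_singleton []).union (Set.finite_iUnion fun i =>
      (h i).image fun u => letter i :: u)).subset fun v hv => ?_
    cases v with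
    | nil => simp
    | cons i u =>
      obtain ⟨hi, hu⟩ := (cons_mem_node f i u).1 hv
      exact Or.inr (Set.mem_iUnion.2 ⟨⟨i, hi⟩, u, hu, rfl⟩)

theorem finsum_mem_one_eq_ncard {α : Type*} (s : Set α) (hs : s.Finite) :
    ∑ᶠ a ∈ s, (1 : ℕ) = s.ncard := by
  rw [finsum_mem_eq_finite_toFinset_sum _ hs, Finset.sum_const, smul_eq_mul, mul_one,
    Set.ncard_eq_toFinset_card s hs]

theorem ncard_node (f : Fin d → PlaneTree D) (hf : ∀ i, (f i).verts.Finite) :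
    (node d f).verts.ncard = 1 + ∑ i, (f i).verts.ncard := by
  rw [← finsum_mem_one_eq_ncard _ ((finite_node_iff f).2 hf),
    finsum_insert_nil_iUnion _ (fun i => (f i).verts) hf (root_mem _) (cons_mem_node f)]
  congr 1
  exact Finset.sum_congr rfl fun i _ => finsum_mem_one_eq_ncard _ (hf i)

theorem energy_node (E : Fin (D + 1) → ℝ) (f : Fin d → PlaneTree D)
    (hf : ∀ i, (f i).verts.Finite) :
    (node d f).energy E = E d + ∑ i, (f i).energy E := by
  rw [energy, finsum_insert_nil_iUnion _ (fun i => (f i).verts) hf (root_mem _)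
    (cons_mem_node f), deg_node_nil]
  simp only [deg_node_cons]
  rfl

theorem finsum_lt_node {M : Type*} [AddCommMonoid M] (n : ℕ) (f : Fin d → PlaneTree D)
    (g : List (Fin D) → M) :
    ∑ᶠ v ∈ {v | v ∈ (node d f).verts ∧ v.length < n + 1}, g v =
      g [] + ∑ i, ∑ᶠ u ∈ {u | u ∈ (f i).verts ∧ u.length < n}, g (letter i :: u) := by
  refine finsum_insert_nil_iUnion _ (fun i => {u | u ∈ (f i).verts ∧ u.length < n})
    (fun i => finite_length_le n _ fun v hv => hv.2.le) (by exact ⟨root_mem _, Nat.succ_pos n⟩)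
    (fun i u => ?_) g
  simp only [Set.mem_ofPred_eq, cons_mem_node, List.length_cons, add_lt_add_iff_right]
  exact ⟨fun ⟨⟨h, hu⟩, hn⟩ => ⟨h, hu, hn⟩, fun ⟨h, hu, hn⟩ => ⟨⟨h, hu⟩, hn⟩⟩

theorem innerEnergy_succ_node (E : Fin (D + 1) → ℝ) (n : ℕ) (f : Fin d → PlaneTree D) :
    (node d f).innerEnergy E (n + 1) = E d + ∑ i, (f i).innerEnergy E n := by
  rw [innerEnergy, finsum_lt_node, deg_node_nil]
  simp only [deg_node_cons]
  rfl

theorem numBelow_succ_node (n : ℕ) (f : Fin d → PlaneTree D) :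
    (node d f).numBelow (n + 1) = 1 + ∑ i, (f i).numBelow n := by
  rw [numBelow, ← finsum_mem_one_eq_ncard _ (finite_length_le (n + 1) _ fun v hv => hv.2.le),
    finsum_lt_node]
  congr 1
  exact Finset.sum_congr rfl fun i _ =>
    finsum_mem_one_eq_ncard _ (finite_length_le n _ fun v hv => hv.2.le)

theorem numBelow_succ (n : ℕ) (T : PlaneTree D) :
    T.numBelow (n + 1) = T.numBelow n + T.numAt n := by
  rw [numBelow, numBelow, numAt, ← Set.ncard_union_eq ?_
    (finite_length_le n _ fun v hv => hv.2.le) (finite_length_le n _ fun v hv => hv.2.le)]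
  · congr 1
    ext v
    simp only [Set.mem_ofPred_eq, Set.mem_union, ← and_or_left]
    exact and_congr_right fun _ => by omega
  · rw [Set.disjoint_left]
    rintro v ⟨-, h1⟩ ⟨-, h2⟩
    omega

/-- Obtained by differencing the recursion for `numBelow`, in which the contribution of the root
cancels. -/
theorem numAt_succ_node (n : ℕ) (f : Fin d → PlaneTree D) :
    (node d f).numAt (n + 1) = ∑ i, (f i).numAt n := by
  have h := numBelow_succ (n + 1) (node d f)
  rw [numBelow_succ_node, numBelow_succ_node] at h
  simp only [numBelow_succ, Finset.sum_add_distrib] at h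
  omega

theorem numAt_zero (T : PlaneTree D) : T.numAt 0 = 1 := by
  have : {v | v ∈ T.verts ∧ v.length = 0} = {[]} := by
    ext v
    simp only [List.length_eq_zero_iff, Set.mem_ofPred_eq, Set.mem_singleton_iff,
      and_iff_right_iff_imp]
    rintro rfl
    exact T.root_mem
  rw [numAt, this, Set.ncard_singleton]

theorem numBelow_zero (T : PlaneTree D) : T.numBelow 0 = 0 := by
  simp [numBelow]

theorem innerEnergy_zero (E : Fin (D + 1) → ℝ) (T : PlaneTree D) : T.innerEnergy E 0 = 0 := by
  simp [innerEnergy]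

/-! ### Generating functions of trees -/

/-- The trees in `A` with `N` vertices. -/
def ofOrderIn (A : Set (PlaneTree D)) (N : ℕ) : Finset (PlaneTree D) :=
  ((finite_ofOrder D N).inter_of_left A).toFinset

theorem mem_ofOrderIn {A : Set (PlaneTree D)} {N : ℕ} {T : PlaneTree D} :
    T ∈ ofOrderIn A N ↔ T ∈ ofOrder D N ∧ T ∈ A := by
  simp [ofOrderIn]

open PowerSeries in
/-- The generating function of the Boltzmann weights of the finite trees in `A`. -/
def genFun (E : Fin (D + 1) → ℝ) (β : ℝ) (A : Set (PlaneTree D)) : ℝ⟦X⟧ :=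
  PowerSeries.mk fun N => ∑ T ∈ ofOrderIn A N, Real.exp (-β * T.energy E)

open PowerSeries in
theorem coeff_zero_genFun (E : Fin (D + 1) → ℝ) (β : ℝ) (A : Set (PlaneTree D)) :
    coeff 0 (genFun E β A) = 0 := by
  rw [genFun, coeff_mk]
  refine Finset.sum_eq_zero fun T hT => ?_
  have h := ((T.mem_ofOrder_iff 0).1 (mem_ofOrderIn.1 hT).1)
  rw [Set.ncard_eq_zero h.1] at h
  exact absurd T.root_mem (by rw [h.2]; simp)

open PowerSeries in
-- Sizes add up with an extra 1 for the root and energies with an extra `E d`. The terms of the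
-- product correspond to families of branches with prescribed sizes.
theorem genFun_node (E : Fin (D + 1) → ℝ) (β : ℝ) (A : Fin d → Set (PlaneTree D)) :
    genFun E β (node d '' Set.univ.pi A) =
      C (Real.exp (-β * E d)) * X * ∏ i, genFun E β (A i) := by
  classical
  ext N
  rw [mul_assoc, coeff_C_mul]
  cases N with
  | zero => rw [coeff_zero_genFun, coeff_zero_X_mul, mul_zero]
  | succ N =>
    rw [coeff_succ_X_mul, coeff_prod]
    simp only [genFun, coeff_mk]
    simp only [Finset.prod_univ_sum]
    rw [Finset.sum_sigma', Finset.mul_sum]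
    symm
    refine Finset.sum_bij (fun x _ => node d x.2) ?_ ?_ ?_ ?_
    · rintro ⟨l, f⟩ h
      simp only [Finset.mem_sigma, Finset.mem_finsuppAntidiag, Fintype.mem_piFinset,
        mem_ofOrderIn, mem_ofOrder_iff] at h ⊢
      have hfin := fun i => (h.2 i).1.1
      refine ⟨⟨(finite_node_iff f).2 hfin, ?_⟩, f, fun i _ => (h.2 i).2, rfl⟩
      rw [ncard_node f hfin, add_comm, ← h.1.1]
      congr 1
      exact Finset.sum_congr rfl fun i _ => (h.2 i).1.2
    · rintro ⟨l, f⟩ h ⟨l', f'⟩ h' hff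
      obtain rfl := node_injective hff
      simp only [Finset.mem_sigma, Fintype.mem_piFinset,
        mem_ofOrderIn, mem_ofOrder_iff] at h h'
      have : l = l' := Finsupp.ext fun i => by rw [← (h.2 i).1.2, (h'.2 i).1.2]
      rw [this]
    · rintro T hT
      rw [mem_ofOrderIn, mem_ofOrder_iff] at hT
      obtain ⟨⟨hfin, hcard⟩, f, hf, rfl⟩ := hT
      rw [finite_node_iff] at hfin
      rw [ncard_node f hfin] at hcard
      refine ⟨⟨Finsupp.equivFunOnFinite.symm fun i => (f i).verts.ncard, f⟩, ?_, rfl⟩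
      simp only [Finset.mem_sigma, Finset.mem_finsuppAntidiag, Fintype.mem_piFinset,
        mem_ofOrderIn, mem_ofOrder_iff]
      refine ⟨⟨?_, Finset.subset_univ _⟩, fun i => ⟨⟨hfin i, rfl⟩, hf i trivial⟩⟩
      simp only [Finsupp.equivFunOnFinite_symm_apply_apply]
      omega
    · rintro ⟨l, f⟩ h
      simp only [Finset.mem_sigma, Fintype.mem_piFinset,
        mem_ofOrderIn, mem_ofOrder_iff] at h
      rw [energy_node E f fun i => (h.2 i).1.1, ← Real.exp_sum, ← Real.exp_add, mul_add,
        Finset.mul_sum]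

theorem node_image_univ (d : Fin (D + 1)) :
    node d '' Set.univ.pi (fun _ => Set.univ) = {T : PlaneTree D | T.deg [] = d} := by
  ext T
  constructor
  · rintro ⟨f, -, rfl⟩
    exact deg_node_nil f
  · rintro rfl
    obtain ⟨f, hf⟩ := T.exists_eq_node
    exact ⟨f, fun _ _ => trivial, hf.symm⟩

open PowerSeries in
theorem genFun_univ (E : Fin (D + 1) → ℝ) (β : ℝ) :
    genFun E β (Set.univ : Set (PlaneTree D)) = X * ∑ d : Fin (D + 1),
      C (Real.exp (-β * E d)) * genFun E β (Set.univ : Set (PlaneTree D)) ^ (d : ℕ) := by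
  classical
  have h : genFun E β (Set.univ : Set (PlaneTree D)) =
      ∑ d : Fin (D + 1), genFun E β {T : PlaneTree D | T.deg [] = d} := by
    ext N
    rw [map_sum]
    simp only [genFun, coeff_mk]
    rw [← Finset.sum_fiberwise _ fun T => T.deg []]
    refine Finset.sum_congr rfl fun d _ => Finset.sum_congr ?_ fun _ _ => rfl
    ext T
    simp [mem_ofOrderIn]
  conv_lhs => rw [h]
  rw [Finset.mul_sum]
  refine Finset.sum_congr rfl fun d _ => ?_
  rw [← node_image_univ, genFun_node, Finset.prod_const, Finset.card_univ, Fintype.card_fin]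
  ring

open PowerSeries in
/-- The trees with a given root neighbourhood `τ` of radius `n` arise by grafting a tree onto every
vertex of `τ` of height `n`. -/
theorem genFun_trunc_eq (E : Fin (D + 1) → ℝ) (β : ℝ) (n : ℕ) (τ : PlaneTree D)
    (hτ : trunc n τ = τ) :
    genFun E β {T | trunc n T = τ} = C (Real.exp (-β * τ.innerEnergy E n)) *
      X ^ τ.numBelow n * genFun E β (Set.univ : Set (PlaneTree D)) ^ τ.numAt n := by
  induction n generalizing τ with
  | zero =>
    have : {T | trunc 0 T = τ} = Set.univ := by
      ext T
      simp only [Set.mem_ofPred_eq, Set.mem_univ, iff_true]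
      rw [trunc_zero T τ, hτ]
    rw [this, numAt_zero, numBelow_zero, innerEnergy_zero]
    simp
  | succ n ih =>
    obtain ⟨f, hf⟩ := τ.exists_eq_node
    generalize τ.deg [] = d at f hf
    subst hf
    rw [trunc_succ_node] at hτ
    have hf : ∀ i, trunc n (f i) = f i := fun i => congrFun (node_injective hτ) i
    -- At radius at least 1 the neighbourhood shows the degree of the root, and the branches are
    -- constrained independently of each other.
    have : {T | trunc (n + 1) T = node d f} =
        node d '' Set.univ.pi fun i => {T | trunc n T = f i} := by
      ext T
      constructor
      · intro hT
        obtain ⟨g, hg⟩ := T.exists_eq_node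
        have hd : T.deg [] = d := by
          have h1 : trunc (n + 1) T = node d f := hT
          rw [hg, trunc_succ_node] at h1
          have := congrArg (fun S => S.deg []) h1
          simpa only [deg_node_nil] using this
        generalize T.deg [] = e at g hg hd
        subst hd hg
        refine ⟨g, fun i _ => ?_, rfl⟩
        have h1 : trunc (n + 1) (node e g) = node e f := hT
        rw [trunc_succ_node] at h1
        exact congrFun (node_injective h1) i
      · rintro ⟨g, hg, rfl⟩
        change trunc (n + 1) (node d g) = node d f
        rw [trunc_succ_node]
        congr 1
        funext i
        exact hg i trivial
    rw [this, genFun_node, Finset.prod_congr rfl fun i _ => ih (f i) (hf i),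
      Finset.prod_mul_distrib, Finset.prod_mul_distrib, Finset.prod_pow_eq_pow_sum,
      Finset.prod_pow_eq_pow_sum, numAt_succ_node, numBelow_succ_node, innerEnergy_succ_node,
      ← map_prod, ← Real.exp_sum, mul_add, Real.exp_add, map_mul, Finset.mul_sum, pow_add, pow_one]
    ring

end PlaneTree

/-! ### The critical law and the variational problem -/

/-- The law `p i = C e^{-β E i} ρ ^ i` for which `∑ p i = 1` and `∑ i p i = 1`. -/
theorem exists_tilted_meanOne {D : ℕ} (hD : 2 ≤ D) (E : Fin (D + 1) → ℝ) (β : ℝ) :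
    ∃ p ∈ meanOneSimplex D, ∃ C ρ : ℝ, 0 < C ∧ 0 < ρ ∧
      ∀ i : Fin (D + 1), p i = C * Real.exp (-β * E i) * ρ ^ (i : ℕ) := by
  set w : Fin (D + 1) → ℝ := fun i => Real.exp (-β * E i) with hw
  have hw0 : ∀ i, 0 < w i := fun i => Real.exp_pos _
  -- A zero `ρ` of `g` says that the weights `w i ρ^i` have mean one after normalization; it comes
  -- from the intermediate value theorem.
  set g : ℝ → ℝ := fun x => ∑ i : Fin (D + 1), (((i : ℕ) : ℝ) - 1) * w i * x ^ (i : ℕ) with hg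
  have hcont : Continuous g := by fun_prop
  have hg0 : g 0 = -w 0 := by
    rw [hg]
    simp only
    rw [Finset.sum_eq_single 0]
    · simp
    · intro i _ hi
      rw [zero_pow (Fin.val_ne_zero_iff.2 hi), mul_zero]
    · simp
  let two : Fin (D + 1) := ⟨2, by omega⟩
  -- Chosen so that `M ≥ 1` and `w two * M ≥ w 0`: the term of index 2 then outweighs the only
  -- negative term, that of index 0.
  set M : ℝ := 1 + w 0 / w two with hM
  have hM1 : 1 ≤ M := by
    rw [hM]
    linarith [div_pos (hw0 0) (hw0 two)]
  have hgM : 0 ≤ g M := by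
    have h1 : ∑ i ∈ ({0, two} : Finset (Fin (D + 1))), (((i : ℕ) : ℝ) - 1) * w i * M ^ (i : ℕ) ≤
        g M := by
      refine Finset.sum_le_sum_of_subset_of_nonneg (Finset.subset_univ _) fun i _ hi => ?_
      have hi0 : i ≠ 0 := fun h => hi (by simp [h])
      have hi1 : (1 : ℝ) ≤ (i : ℕ) := by
        have : (i : ℕ) ≠ 0 := Fin.val_ne_zero_iff.2 hi0
        exact_mod_cast Nat.one_le_iff_ne_zero.2 this
      have := hw0 i
      have : 0 < M := by linarith
      have : 0 ≤ ((i : ℕ) : ℝ) - 1 := by linarith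
      positivity
    have h02 : (0 : Fin (D + 1)) ≠ two := by simp [two, Fin.ext_iff]
    rw [Finset.sum_pair h02] at h1
    refine le_trans ?_ h1
    have h2 : w two * M = w two + w 0 := by
      rw [hM, mul_add, mul_one, mul_div_cancel₀ _ (hw0 two).ne']
    simp only [two, Fin.val_zero, Nat.cast_zero, pow_zero, Nat.cast_ofNat]
    change w two * M = _ at h2
    have : 0 ≤ w two := (hw0 two).le
    change 0 ≤ (0 - 1) * w 0 * 1 + (2 - 1) * w two * M ^ 2
    nlinarith [mul_le_mul_of_nonneg_left hM1 (mul_nonneg this (by linarith : (0 : ℝ) ≤ M))]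
  obtain ⟨ρ, hρ, hgρ⟩ : (0 : ℝ) ∈ g '' Set.Icc 0 M := by
    refine intermediate_value_Icc (by linarith) hcont.continuousOn ⟨?_, hgM⟩
    rw [hg0]
    linarith [hw0 0]
  have hρ0 : 0 < ρ := by
    refine lt_of_le_of_ne hρ.1 fun h => ?_
    rw [← h, hg0] at hgρ
    linarith [hw0 0]
  set S : ℝ := ∑ i : Fin (D + 1), w i * ρ ^ (i : ℕ) with hS
  have hterm : ∀ i, 0 < w i * ρ ^ (i : ℕ) := fun i => mul_pos (hw0 i) (pow_pos hρ0 _)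
  have hS0 : 0 < S := Finset.sum_pos (fun i _ => hterm i) ⟨0, Finset.mem_univ _⟩
  have hSmean : ∑ i : Fin (D + 1), ((i : ℕ) : ℝ) * (w i * ρ ^ (i : ℕ)) = S := by
    rw [← sub_eq_zero, hS, ← Finset.sum_sub_distrib, ← hgρ]
    exact Finset.sum_congr rfl fun i _ => by ring
  have hsum : ∑ i : Fin (D + 1), S⁻¹ * w i * ρ ^ (i : ℕ) = 1 := by
    simp only [mul_assoc]
    rw [← Finset.mul_sum, ← hS, inv_mul_cancel₀ hS0.ne']
  have hpos : ∀ i : Fin (D + 1), 0 ≤ S⁻¹ * w i * ρ ^ (i : ℕ) := fun i => by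
    rw [mul_assoc]
    exact mul_nonneg (inv_nonneg.2 hS0.le) (hterm i).le
  refine ⟨fun i => S⁻¹ * w i * ρ ^ (i : ℕ), ⟨fun i => ⟨hpos i, ?_⟩, hsum, ?_⟩, S⁻¹, ρ,
    inv_pos.2 hS0, hρ0, fun i => rfl⟩
  · rw [← hsum]
    exact Finset.single_le_sum (f := fun i : Fin (D + 1) => S⁻¹ * w i * ρ ^ (i : ℕ))
      (fun i _ => hpos i) (Finset.mem_univ i)
  · refine Eq.trans ?_ ((congrArg (S⁻¹ * ·) hSmean).trans (inv_mul_cancel₀ hS0.ne'))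
    simp only
    rw [Finset.mul_sum]
    exact Finset.sum_congr rfl fun i _ => by ring

section Tilted

variable {D : ℕ} {E : Fin (D + 1) → ℝ} {β : ℝ} {p : Fin (D + 1) → ℝ} {C ρ : ℝ}

/-- `ln p_i + β E_i` is affine in `i`, so its mean under `q` depends only on the mass and the mean
of `q`. -/
theorem sum_mul_log_add_tilted (hC : 0 < C) (hρ : 0 < ρ)
    (hp : ∀ i : Fin (D + 1), p i = C * Real.exp (-β * E i) * ρ ^ (i : ℕ)) {q : Fin (D + 1) → ℝ}
    (hq : q ∈ meanOneSimplex D) :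
    ∑ i, q i * Real.log (p i) + β * ∑ i, q i * E i = Real.log (C * ρ) := by
  have hlog : ∀ i : Fin (D + 1),
      Real.log (p i) = Real.log C - β * E i + ((i : ℕ) : ℝ) * Real.log ρ := by
    intro i
    rw [hp, Real.log_mul (mul_pos hC (Real.exp_pos _)).ne' (pow_pos hρ _).ne',
      Real.log_mul hC.ne' (Real.exp_pos _).ne', Real.log_exp, Real.log_pow]
    ring
  calc ∑ i, q i * Real.log (p i) + β * ∑ i, q i * E i
      = (∑ i, q i) * Real.log C + (∑ i : Fin (D + 1), ((i : ℕ) : ℝ) * q i) * Real.log ρ := by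
        rw [Finset.mul_sum, Finset.sum_mul, Finset.sum_mul, ← Finset.sum_add_distrib,
          ← Finset.sum_add_distrib]
        exact Finset.sum_congr rfl fun i _ => by rw [hlog]; ring
    _ = Real.log (C * ρ) := by
        rw [hq.2.1, hq.2.2, one_mul, one_mul, Real.log_mul hC.ne' hρ.ne']

theorem freeEnergy_tilted (hC : 0 < C) (hρ : 0 < ρ) (hpΔ : p ∈ meanOneSimplex D)
    (hp : ∀ i : Fin (D + 1), p i = C * Real.exp (-β * E i) * ρ ^ (i : ℕ)) :
    freeEnergy E β p = Real.log (C * ρ) := by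
  rw [freeEnergy, neg_neg, sum_mul_log_add_tilted hC hρ hp hpΔ]

/-- By `sum_mul_log_add_tilted`, the difference `J(q) - J(p)` is the relative entropy of `q` with
respect to `p`, which is nonnegative. -/
theorem isMinOn_freeEnergy_tilted (hC : 0 < C) (hρ : 0 < ρ) (hpΔ : p ∈ meanOneSimplex D)
    (hp : ∀ i : Fin (D + 1), p i = C * Real.exp (-β * E i) * ρ ^ (i : ℕ)) :
    IsMinOn (freeEnergy E β) (meanOneSimplex D) p := by
  intro q hq
  change freeEnergy E β p ≤ freeEnergy E β q
  rw [freeEnergy_tilted hC hρ hpΔ hp, ← sum_mul_log_add_tilted hC hρ hp hq, freeEnergy, neg_neg]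
  refine add_le_add_left ?_ _
  have hp0 : ∀ i, 0 < p i := fun i => by
    rw [hp]
    exact mul_pos (mul_pos hC (Real.exp_pos _)) (pow_pos hρ _)
  -- This is `ln x ≤ x - 1` at `x = p i / q i`; for `q i = 0` it holds since the entropy term is
  -- then 0.
  have h : ∀ i, q i * Real.log (p i) + (q i - p i) ≤ q i * Real.log (q i) := by
    intro i
    rcases (hq.1 i).1.eq_or_lt with h0 | h0
    · rw [← h0]
      simp [(hp0 i).le]
    · have h1 := Real.log_le_sub_one_of_pos (div_pos (hp0 i) h0)
      rw [Real.log_div (hp0 i).ne' h0.ne'] at h1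
      have h2 := mul_le_mul_of_nonneg_left h1 h0.le
      have h3 : q i * (p i / q i - 1) = p i - q i := by field_simp
      rw [h3] at h2
      linarith
  have h2 := Finset.sum_le_sum fun i (_ : i ∈ Finset.univ) => h i
  rw [Finset.sum_add_distrib, Finset.sum_sub_distrib, hq.2.1, hpΔ.2.1] at h2
  linarith

end Tilted

/-! ### Limits of the quotients of partition functions -/

namespace PlaneTree

open PowerSeries

variable {D : ℕ}

theorem coeff_genFun_univ_pos (hD : 1 ≤ D) (E : Fin (D + 1) → ℝ) (β : ℝ) (n : ℕ) :
    0 < coeff (n + 1) (genFun E β (Set.univ : Set (PlaneTree D))) := by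
  rw [genFun, coeff_mk]
  obtain ⟨T, hT⟩ := nonempty_ofOrder D hD ⟨n + 1, Nat.succ_pos n⟩
  exact Finset.sum_pos (fun _ _ => Real.exp_pos _) ⟨T, mem_ofOrderIn.2 ⟨hT, trivial⟩⟩

/-- Exponential tilting: replacing `x` by `c ρ x` and dividing by `ρ` changes the weight `e^{-β
E_i}` in the equation for `Z` into `c e^{-β E_i} ρ^i = p i`. -/
theorem isCriticalProgeny_genFun (hD : 2 ≤ D) {E : Fin (D + 1) → ℝ} {β : ℝ}
    {p : Fin (D + 1) → ℝ} {c ρ : ℝ} (hc : 0 < c) (hρ : 0 < ρ) (hpΔ : p ∈ meanOneSimplex D)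
    (hp : ∀ i : Fin (D + 1), p i = c * Real.exp (-β * E i) * ρ ^ (i : ℕ)) :
    IsCriticalProgeny (∑ i : Fin (D + 1), Polynomial.C (p i) * Polynomial.X ^ (i : ℕ))
      (C ρ⁻¹ * rescale (c * ρ) (genFun E β (Set.univ : Set (PlaneTree D)))) := by
  have hp0 : ∀ i, 0 < p i := fun i => by
    rw [hp]
    exact mul_pos (mul_pos hc (Real.exp_pos _)) (pow_pos hρ _)
  have hcoeff : ∀ i : Fin (D + 1),
      (∑ i : Fin (D + 1), Polynomial.C (p i) * Polynomial.X ^ (i : ℕ)).coeff i = p i := by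
    intro i
    rw [Polynomial.finsetSum_coeff, Finset.sum_eq_single i]
    · simp
    · intro j _ hj
      rw [Polynomial.coeff_C_mul_X_pow, if_neg fun h => hj (Fin.ext h.symm)]
    · simp
  refine ⟨fun n => ?_, ?_, ?_, ?_, ?_, ?_, ?_, fun n => ?_⟩
  · rw [Polynomial.finsetSum_coeff]
    refine Finset.sum_nonneg fun i _ => ?_
    rw [Polynomial.coeff_C_mul_X_pow]
    split_ifs
    · exact (hp0 i).le
    · exact le_rfl
  · exact (hcoeff ⟨0, by omega⟩).symm ▸ hp0 _
  · exact (hcoeff ⟨1, by omega⟩).symm ▸ hp0 _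
  · exact (hcoeff ⟨2, by omega⟩).symm ▸ hp0 _
  · rw [Polynomial.eval_finsetSum]
    refine Eq.trans ?_ hpΔ.2.1
    simp
  · rw [Polynomial.derivative_sum, Polynomial.eval_finsetSum]
    refine Eq.trans ?_ hpΔ.2.2
    refine Finset.sum_congr rfl fun i _ => ?_
    simp only [Polynomial.derivative_C_mul_X_pow, Polynomial.eval_mul, Polynomial.eval_C,
      Polynomial.eval_pow, Polynomial.eval_X, one_pow, mul_one]
    ring
  · set Z := genFun E β (Set.univ : Set (PlaneTree D)) with hZ
    rw [map_sum]
    conv_lhs => rw [hZ, genFun_univ, ← hZ]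
    rw [map_mul, rescale_X, map_sum, Finset.mul_sum, Finset.mul_sum, Finset.mul_sum]
    refine Finset.sum_congr rfl fun i _ => ?_
    rw [map_mul (rescale _), map_mul (Polynomial.aeval _), map_pow, map_pow, Polynomial.aeval_X,
      Polynomial.aeval_C, mul_pow, ← map_pow C]
    have e1 : rescale (c * ρ) (C (Real.exp (-β * E i))) = C (Real.exp (-β * E i)) := by
      ext n
      rw [coeff_rescale, coeff_C]
      split_ifs with h
      · simp [h]
      · simp
    have e2 : algebraMap ℝ ℝ⟦X⟧ (p i) = C (p i) := rfl
    rw [e1, e2, hp]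
    have e3 : ρ⁻¹ * (c * ρ) * Real.exp (-β * E i) =
        c * Real.exp (-β * E i) * ρ ^ (i : ℕ) * ρ⁻¹ ^ (i : ℕ) := by
      rw [inv_pow]
      field_simp
    have e4 := congrArg (C : ℝ → ℝ⟦X⟧) e3
    rw [map_mul C, map_mul C, map_mul C _ (ρ⁻¹ ^ (i : ℕ))] at e4
    linear_combination X * rescale (c * ρ) Z ^ (i : ℕ) * e4
  · rw [coeff_C_mul, coeff_rescale]
    exact mul_pos (inv_pos.2 hρ)
      (mul_pos (pow_pos (mul_pos hc hρ) _) (coeff_genFun_univ_pos (by omega) E β n))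

theorem coeff_genFun_trunc_eq (E : Fin (D + 1) → ℝ) (β : ℝ) (n : ℕ) (τ : PlaneTree D)
    (hτ : trunc n τ = τ) {N : ℕ} (hN : τ.numBelow n ≤ N) :
    coeff N (genFun E β {T | trunc n T = τ}) = Real.exp (-β * τ.innerEnergy E n) *
      coeff (N - τ.numBelow n) (genFun E β (Set.univ : Set (PlaneTree D)) ^ τ.numAt n) := by
  rw [genFun_trunc_eq E β n τ hτ, mul_assoc, coeff_C_mul, coeff_X_pow_mul', if_pos hN]

/-- Undoing the tilting in `[x^{N-m}] Z^k / [x^N] Z` leaves the factor `ρ^{k-1} (c ρ)^m` in front of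
the quotient for `Q`, whose limit is `k`. -/
theorem tendsto_coeff_genFun_trunc_eq (hD : 2 ≤ D) {E : Fin (D + 1) → ℝ} {β : ℝ}
    {p : Fin (D + 1) → ℝ} {c ρ : ℝ} (hc : 0 < c) (hρ : 0 < ρ) (hpΔ : p ∈ meanOneSimplex D)
    (hp : ∀ i : Fin (D + 1), p i = c * Real.exp (-β * E i) * ρ ^ (i : ℕ)) (n : ℕ)
    (τ : PlaneTree D) (hτ : trunc n τ = τ) :
    Tendsto (fun N => coeff N (genFun E β {T | trunc n T = τ}) /
      coeff N (genFun E β (Set.univ : Set (PlaneTree D)))) atTop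
      (𝓝 (Real.exp (-β * τ.innerEnergy E n) * (ρ ^ τ.numAt n * ρ⁻¹ * (c * ρ) ^ τ.numBelow n *
        τ.numAt n))) := by
  set Z := genFun E β (Set.univ : Set (PlaneTree D)) with hZ
  have hcrit := isCriticalProgeny_genFun hD hc hρ hpΔ hp
  rw [← hZ] at hcrit
  have hlim := hcrit.tendsto_coeff_pow_div (τ.numAt n) (τ.numBelow n)
  refine ((hlim.const_mul (ρ ^ τ.numAt n * ρ⁻¹ * (c * ρ) ^ τ.numBelow n)).const_mul
    (Real.exp (-β * τ.innerEnergy E n))).congr' ?_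
  filter_upwards [eventually_ge_atTop (τ.numBelow n + 1)] with N hN
  rw [coeff_genFun_trunc_eq E β n τ hτ (by omega), ← hZ, mul_div_assoc]
  congr 1
  obtain ⟨j, rfl⟩ : ∃ j, N = τ.numBelow n + j := ⟨N - τ.numBelow n, by omega⟩
  have hz : coeff (τ.numBelow n + j) Z ≠ 0 := by
    have := coeff_genFun_univ_pos (by omega : 1 ≤ D) E β (τ.numBelow n + j - 1)
    rw [Nat.sub_add_cancel (by omega)] at this
    exact this.ne'
  rw [Nat.add_sub_cancel_left, mul_pow (C ρ⁻¹), ← map_pow C, ← map_pow (rescale _), coeff_C_mul, coeff_C_mul,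
    coeff_rescale, coeff_rescale]
  have hσ : 0 < c * ρ := mul_pos hc hρ
  generalize c * ρ = σ at hσ
  rw [inv_pow, pow_add]
  field_simp

/-- The ratios of partition functions that give the limit law of the root neighbourhoods. -/
theorem exists_tendsto_coeff_genFun (hD : 1 ≤ D) (E : Fin (D + 1) → ℝ) (β : ℝ) :
    ∃ L : ℕ → PlaneTree D → ℝ,
      (∀ n τ, trunc n τ = τ → Tendsto (fun N => coeff N (genFun E β {T | trunc n T = τ}) /
        coeff N (genFun E β (Set.univ : Set (PlaneTree D)))) atTop (𝓝 (L n τ))) ∧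
      (∀ n τ, τ.numAt n = 0 → L n τ = 0) ∧
      (2 ≤ D → ∃ p ∈ meanOneSimplex D, IsMinOn (freeEnergy E β) (meanOneSimplex D) p ∧
        ∃ C ρ : ℝ, 0 < C ∧ 0 < ρ ∧
          (∀ i : Fin (D + 1), p i = C * Real.exp (-β * E i) * ρ ^ (i : ℕ)) ∧
          ∀ n τ, 1 ≤ n → L n τ =
            C * τ.numAt n * Real.exp (-β * τ.innerEnergy E n) * ρ ^ τ.numAt n *
              Real.exp (freeEnergy E β p) ^ (τ.numBelow n - 1)) := by
  rcases hD.eq_or_lt with hD1 | hD2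
  · subst hD1
    set Z := genFun E β (Set.univ : Set (PlaneTree 1)) with hZ
    set w := Real.exp (-β * E 1) with hw
    have hw0 : 0 < w := Real.exp_pos _
    -- For `D = 1` there is one tree of each order, a path, and one more vertex multiplies its
    -- weight by `e^{-β E_1}`.
    have hrec : ∀ N, coeff (N + 2) Z = w * coeff (N + 1) Z := by
      intro N
      conv_lhs => rw [hZ, genFun_univ, ← hZ]
      rw [coeff_succ_X_mul, Fin.sum_univ_two, map_add, coeff_C_mul, coeff_C_mul]
      simp [coeff_one, hw]
    have hpow : ∀ m N, coeff (N + 1 + m) Z = w ^ m * coeff (N + 1) Z := by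
      intro m N
      induction m with
      | zero => simp
      | succ m ih =>
        rw [pow_succ', mul_assoc, ← ih, ← add_assoc, add_right_comm N 1 m, hrec (N + m)]
    have hle : ∀ (n : ℕ) (τ : PlaneTree 1), τ.numAt n ≤ 1 := by
      intro n τ
      rw [numAt, Set.ncard_le_one (finite_length_le n _ fun v hv => hv.2.le)]
      rintro u ⟨-, hu⟩ v ⟨-, hv⟩
      exact List.ext_getElem (hu.trans hv.symm) fun i _ _ => Subsingleton.elim _ _
    refine ⟨fun n τ => if τ.numAt n = 0 then 0 else
      Real.exp (-β * τ.innerEnergy E n) * (w ^ τ.numBelow n)⁻¹, fun n τ hτ => ?_,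
      fun n τ h => if_pos h, fun h => absurd h (by norm_num)⟩
    refine tendsto_const_nhds.congr' ?_
    filter_upwards [eventually_ge_atTop (τ.numBelow n + 1)] with N hN
    rw [coeff_genFun_trunc_eq E β n τ hτ (by omega), ← hZ]
    obtain ⟨j, rfl⟩ : ∃ j, N = j + 1 + τ.numBelow n := ⟨N - τ.numBelow n - 1, by omega⟩
    rw [Nat.add_sub_cancel]
    split_ifs with h0
    · rw [h0, pow_zero, coeff_one, if_neg (by omega), mul_zero, zero_div]
    · have h1 : τ.numAt n = 1 := by
        have := hle n τ
        omega
      have hz := coeff_genFun_univ_pos le_rfl E β j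
      rw [← hZ] at hz
      rw [h1, pow_one, hpow]
      field_simp
  · obtain ⟨p, hpΔ, C, ρ, hC, hρ, hp⟩ := exists_tilted_meanOne hD2 E β
    refine ⟨fun n τ => Real.exp (-β * τ.innerEnergy E n) * (ρ ^ τ.numAt n * ρ⁻¹ *
      (C * ρ) ^ τ.numBelow n * τ.numAt n), fun n τ hτ =>
      tendsto_coeff_genFun_trunc_eq hD2 hC hρ hpΔ hp n τ hτ, fun n τ h => by simp [h],
      fun _ => ⟨p, hpΔ, isMinOn_freeEnergy_tilted hC hρ hpΔ hp, C, ρ, hC, hρ, hp,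
        fun n τ hn => ?_⟩⟩
    -- For `n ≥ 1` the root has height less than `n`, so `m - 1` is a genuine subtraction.
    have hm : 0 < τ.numBelow n :=
      (Set.ncard_pos (finite_length_le n _ fun v hv => hv.2.le)).2 ⟨[], τ.root_mem, hn⟩
    obtain ⟨m, hm'⟩ : ∃ m, τ.numBelow n = m + 1 := ⟨τ.numBelow n - 1, by omega⟩
    simp only
    rw [freeEnergy_tilted hC hρ hpΔ hp, Real.exp_log (mul_pos hC hρ), hm', Nat.add_sub_cancel,
      pow_succ]
    field_simp

end PlaneTree

/-! ### The coding of trees and its image -/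

namespace PlaneTree

variable {D : ℕ}

theorem trunc_trunc_of_le {m n : ℕ} (h : n ≤ m) (T : PlaneTree D) :
    trunc n (trunc m T) = trunc n T := by
  ext v
  simp only [trunc, Set.mem_ofPred_eq]
  exact ⟨fun ⟨⟨h1, _⟩, h2⟩ => ⟨h1, h2⟩, fun ⟨h1, h2⟩ => ⟨⟨h1, h2.trans h⟩, h2⟩⟩

theorem trunc_idem (n : ℕ) (T : PlaneTree D) : trunc n (trunc n T) = trunc n T :=
  trunc_trunc_of_le le_rfl T

theorem children_eq_of_length_eq {T T' : PlaneTree D} {v : List (Fin D)}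
    (h : (T.children v).length = (T'.children v).length) : T.children v = T'.children v := by
  classical
  have hmem : ∀ i, v ++ [i] ∈ T.verts ↔ v ++ [i] ∈ T'.verts := by
    intro i
    rw [append_singleton_mem_iff, append_singleton_mem_iff]
    change (i : ℕ) < (T.children v).length ↔ (i : ℕ) < (T'.children v).length
    rw [h]
  unfold children
  congr 1
  exact List.filter_congr fun i _ => by simp [hmem i]

/-- Recovers the degree of a vertex from its multiplicity in the list of parents of the next level.
-/
theorem count_map_dropLast_flatMap (T : PlaneTree D) (L : List (List (Fin D)))
    (v : List (Fin D)) :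
    ((L.flatMap T.children).map List.dropLast).count v = L.count v * (T.children v).length := by
  induction L with
  | nil => simp
  | cons u L ih =>
    have hrep : (T.children u).map List.dropLast = List.replicate (T.children u).length u := by
      rw [List.eq_replicate_iff]
      refine ⟨by simp, fun w hw => ?_⟩
      obtain ⟨z, hz, rfl⟩ := List.mem_map.1 hw
      obtain ⟨i, rfl, -⟩ := (T.mem_children u z).1 hz
      simp
    rw [List.flatMap_cons, List.map_append, List.count_append, ih, hrep, List.count_replicate,
      List.count_cons]
    by_cases huv : u = v
    · subst huv
      simp
      ring
    · simp [huv]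

theorem parentCode_eq_zero_iff (T : PlaneTree D) (n l : ℕ) :
    T.parentCode n l = 0 ↔ (T.level (n + 1)).length ≤ l := by
  unfold parentCode
  split_ifs with h
  · simpa using h
  · simpa using h

/-- Zeros in the code reveal the length of the next level, and the nonzero entries its list of
parents. Multiplicities in that list give the degrees, and these give the children. -/
theorem level_succ_eq_of_code_eq {T T' : PlaneTree D} {n : ℕ} (hL : T.level n = T'.level n)
    (hc : T.code n = T'.code n) : T.level (n + 1) = T'.level (n + 1) := by
  have hpc : ∀ l, T.parentCode n l = T'.parentCode n l := by
    intro l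
    by_cases hl : l < D ^ (n + 1)
    · have := congrArg Fin.val (congrFun hc ⟨l, hl⟩)
      simpa [code] using this
    · rw [(T.parentCode_eq_zero_iff n l).2 ((T.length_level_le _).trans (not_lt.1 hl)),
        (T'.parentCode_eq_zero_iff n l).2 ((T'.length_level_le _).trans (not_lt.1 hl))]
  have hlen : (T.level (n + 1)).length = (T'.level (n + 1)).length := by
    have h : ∀ l, (T.level (n + 1)).length ≤ l ↔ (T'.level (n + 1)).length ≤ l := fun l => by
      rw [← parentCode_eq_zero_iff, hpc, parentCode_eq_zero_iff]
    exact le_antisymm ((h _).2 le_rfl) ((h _).1 le_rfl)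
  have hdrop : (T.level (n + 1)).map List.dropLast = (T'.level (n + 1)).map List.dropLast := by
    refine List.ext_getElem (by simpa using hlen) fun l h1 h2 => ?_
    rw [List.length_map] at h1 h2
    have h := hpc l
    unfold parentCode at h
    rw [dif_pos h1, dif_pos h2, hL, Nat.add_right_cancel_iff] at h
    rw [List.getElem_map, List.getElem_map]
    exact (List.idxOf_inj (hL ▸ T.dropLast_mem_level (List.getElem_mem h1))).1 h
  simp only [level] at hdrop ⊢
  rw [← hL] at hdrop ⊢
  have hch : ∀ v ∈ T.level n, T.children v = T'.children v := by
    intro v hv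
    have h := congrArg (List.count v) hdrop
    rw [count_map_dropLast_flatMap, count_map_dropLast_flatMap] at h
    exact children_eq_of_length_eq (Nat.eq_of_mul_eq_mul_left (List.count_pos_iff.2 hv) h)
  rw [List.flatMap_def, List.flatMap_def, List.map_congr_left hch]

theorem trunc_eq_trunc_iff (T T' : PlaneTree D) (n : ℕ) :
    trunc n T = trunc n T' ↔ ∀ m < n, T.code m = T'.code m := by
  constructor
  · intro h m hm
    have h' := congrArg (fun S => code S m) h
    simp only [code_trunc] at h'
    rwa [if_pos (Nat.succ_le_of_lt hm), if_pos (Nat.succ_le_of_lt hm)] at h'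
  · intro h
    have hlev : ∀ m ≤ n, T.level m = T'.level m := by
      intro m hm
      induction m with
      | zero => rfl
      | succ m ih => exact level_succ_eq_of_code_eq (ih (by omega)) (h m hm)
    ext v
    simp only [trunc, Set.mem_ofPred_eq]
    refine and_congr_left fun hv => ?_
    have h1 := T.mem_level v.length v
    have h2 := T'.mem_level v.length v
    rw [hlev _ hv] at h1
    simpa using h1.symm.trans h2

theorem ext_trunc {T T' : PlaneTree D} (h : ∀ n, trunc n T = trunc n T') : T = T' := by
  ext v
  have hv : v ∈ (trunc v.length T).verts ↔ v ∈ (trunc v.length T').verts := by rw [h]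
  simpa [trunc] using hv

theorem code_injective : Function.Injective (code : PlaneTree D → CodeSpace D) := fun T T' h =>
  ext_trunc fun n => (trunc_eq_trunc_iff T T' n).2 fun m _ => congrFun h m

instance : MeasurableSingletonClass (PlaneTree D) where
  measurableSet_singleton T :=
    ⟨{T.code}, measurableSet_singleton _, by
      ext S
      simpa using code_injective.eq_iff⟩

theorem finite_range_trunc (n : ℕ) : (Set.range (trunc n : PlaneTree D → PlaneTree D)).Finite := by
  have hfin : {v : List (Fin D) | v.length ≤ n}.Finite := List.finite_length_le (Fin D) n
  refine Set.Finite.of_finite_image (f := PlaneTree.verts) (hfin.finite_subsets.subset ?_)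
    (fun S _ T _ h => PlaneTree.ext h)
  rintro _ ⟨_, ⟨T, rfl⟩, rfl⟩ v hv
  exact hv.2

/-- The trees of height at most `n`. -/
def treesUpTo (D n : ℕ) : Finset (PlaneTree D) := (finite_range_trunc n).toFinset

theorem mem_treesUpTo {n : ℕ} {τ : PlaneTree D} : τ ∈ treesUpTo D n ↔ trunc n τ = τ := by
  rw [treesUpTo, Set.Finite.mem_toFinset]
  exact ⟨by rintro ⟨T, rfl⟩; exact trunc_idem n T, fun h => ⟨τ, h⟩⟩

theorem trunc_mem_treesUpTo (n : ℕ) (T : PlaneTree D) : trunc n T ∈ treesUpTo D n :=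
  mem_treesUpTo.2 (trunc_idem n T)

theorem trunc_eq_of_mem_ofHeight {n : ℕ} {τ : PlaneTree D} (h : τ ∈ ofHeight D n) :
    trunc n τ = τ := by
  ext v
  simp only [trunc, Set.mem_ofPred_eq, and_iff_left_iff_imp]
  exact fun hv => h.2 ⟨v, hv, rfl⟩

theorem numAt_eq_zero_of_notMem_ofHeight {n : ℕ} {τ : PlaneTree D} (hτ : trunc n τ = τ)
    (h : τ ∉ ofHeight D n) : τ.numAt n = 0 := by
  by_contra h0
  have hne : {v | v ∈ τ.verts ∧ v.length = n}.Nonempty :=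
    (Set.ncard_pos (finite_length_le n _ fun v hv => hv.2.le)).1 (Nat.pos_of_ne_zero h0)
  obtain ⟨v, hv, hvn⟩ := hne
  refine h ⟨⟨v, hv, hvn⟩, ?_⟩
  rintro _ ⟨u, hu, rfl⟩
  rw [← hτ] at hu
  exact hu.2

/-- The codes that agree with `x` up to level `n`. -/
def cylinder (n : ℕ) (x : CodeSpace D) : Set (CodeSpace D) := {y | ∀ m < n, y m = x m}

theorem isClopen_cylinder (n : ℕ) (x : CodeSpace D) : IsClopen (cylinder n x) := by
  have : cylinder n x = ⋂ m ∈ Finset.range n, (fun y : CodeSpace D => y m) ⁻¹' {x m} := by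
    ext y
    simp [cylinder]
  rw [this]
  exact isClopen_biInter_finset fun m _ => (isClopen_discrete {x m}).preimage (continuous_apply m)

theorem trunc_preimage_singleton {n : ℕ} {τ : PlaneTree D} (hτ : trunc n τ = τ) :
    trunc n ⁻¹' {τ} = code ⁻¹' cylinder n τ.code := by
  ext T
  simp only [Set.mem_preimage, Set.mem_singleton_iff, cylinder, Set.mem_ofPred_eq]
  rw [← trunc_eq_trunc_iff, hτ]

/-- Exhibits the set of codes as an intersection of clopen sets, so that it is closed and limits of
laws on trees cannot leave it. -/
theorem range_code : Set.range (code : PlaneTree D → CodeSpace D) =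
    ⋂ n, ⋃ τ ∈ treesUpTo D n, cylinder n τ.code := by
  ext x
  simp only [Set.mem_range, Set.mem_iInter, Set.mem_iUnion, exists_prop]
  constructor
  · rintro ⟨T, rfl⟩ n
    refine ⟨trunc n T, trunc_mem_treesUpTo n T, ?_⟩
    exact (trunc_eq_trunc_iff T (trunc n T) n).1 (trunc_idem n T).symm
  · intro h
    choose S hS hx using h
    have key : ∀ m n, m ≤ n → trunc m (S n) = trunc m (S m) := fun m n hmn =>
      (trunc_eq_trunc_iff _ _ m).2 fun k hk => by rw [← hx n k (by omega), ← hx m k hk]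
    have key' : ∀ (v : List (Fin D)) (n : ℕ), v.length ≤ n →
        (v ∈ (S n).verts ↔ v ∈ (S v.length).verts) := by
      intro v n hn
      have : v ∈ (trunc v.length (S n)).verts ↔ v ∈ (trunc v.length (S v.length)).verts := by
        rw [key _ _ hn]
      simpa [trunc] using this
    -- The chosen finite trees are compatible and are glued: `v` is a vertex if it is one in the
    -- tree chosen for the level of `v`.
    let T : PlaneTree D := ⟨{v | v ∈ (S v.length).verts}, root_mem _, fun v i hv =>
      (key' v (v ++ [i]).length (by simp)).1 ((S _).parent_mem v i hv), fun v i j hij hv => by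
        have h1 := (S _).sibling_mem v i j hij hv
        have e : (v ++ [i]).length = (v ++ [j]).length := by simp
        rw [e] at h1
        exact h1⟩
    have hT : ∀ n, trunc n T = trunc n (S n) := by
      intro n
      ext v
      simp only [trunc, Set.mem_ofPred_eq]
      exact and_congr_left fun hv => (key' v n hv).symm
    refine ⟨T, funext fun m => ?_⟩
    rw [hx (m + 1) m (Nat.lt_succ_self m)]
    exact (trunc_eq_trunc_iff _ _ (m + 1)).1 (hT (m + 1)) m (Nat.lt_succ_self m)

theorem isClopen_biUnion_cylinder (n : ℕ) :
    IsClopen (⋃ τ ∈ treesUpTo D n, cylinder n τ.code) :=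
  isClopen_biUnion_finset fun τ _ => isClopen_cylinder n τ.code

theorem measurableEmbedding_code : MeasurableEmbedding (code : PlaneTree D → CodeSpace D) where
  injective := code_injective
  measurable := measurable_code
  measurableSet_image' := by
    rintro _ ⟨B, hB, rfl⟩
    rw [Set.image_preimage_eq_inter_range, range_code]
    exact hB.inter (MeasurableSet.iInter fun n => (isClopen_biUnion_cylinder n).isOpen.measurableSet)

open PowerSeries in
theorem tsum_indicator_weight (E : Fin (D + 1) → ℝ) (β : ℝ) (N : ℕ) (A : Set (PlaneTree D)) :
    ∑' T, A.indicator (weight E β N) T = ENNReal.ofReal (coeff N (genFun E β A)) := by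
  classical
  rw [genFun, coeff_mk, ENNReal.ofReal_sum_of_nonneg fun _ _ => (Real.exp_pos _).le,
    tsum_eq_sum (s := ofOrderIn A N)]
  · refine Finset.sum_congr rfl fun T hT => ?_
    rw [mem_ofOrderIn] at hT
    rw [Set.indicator_of_mem hT.2, weight, if_pos hT.1]
  · intro T hT
    rw [mem_ofOrderIn, not_and_or] at hT
    rcases hT with hT | hT
    · by_cases hA : T ∈ A
      · rw [Set.indicator_of_mem hA, weight, if_neg hT]
      · exact Set.indicator_of_notMem hA _
    · exact Set.indicator_of_notMem hT _

open PowerSeries in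
theorem gibbs_real_apply (hD : 1 ≤ D) (E : Fin (D + 1) → ℝ) (β : ℝ) (N : ℕ+)
    {A : Set (PlaneTree D)} (hA : MeasurableSet A) :
    (gibbs hD E β N : Measure (PlaneTree D)).real A =
      coeff N (genFun E β A) / coeff N (genFun E β (Set.univ : Set (PlaneTree D))) := by
  have h0 : ∀ B : Set (PlaneTree D), 0 ≤ coeff (N : ℕ) (genFun E β B) := fun B => by
    rw [genFun, coeff_mk]
    exact Finset.sum_nonneg fun _ _ => (Real.exp_pos _).le
  have h1 : (gibbs hD E β N : Measure (PlaneTree D)) A =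
      ENNReal.ofReal (coeff N (genFun E β A)) *
        (ENNReal.ofReal (coeff N (genFun E β (Set.univ : Set (PlaneTree D)))))⁻¹ := by
    change (gibbsPMF hD E β N).toMeasure A = _
    rw [PMF.toMeasure_apply _ hA, ← tsum_indicator_weight, ← tsum_indicator_weight,
      Set.indicator_univ, ← ENNReal.tsum_mul_right]
    refine tsum_congr fun T => ?_
    by_cases hT : T ∈ A
    · rw [Set.indicator_of_mem hT, Set.indicator_of_mem hT, gibbsPMF, PMF.normalize_apply]
    · rw [Set.indicator_of_notMem hT, Set.indicator_of_notMem hT, zero_mul]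
  rw [Measure.real, h1, ENNReal.toReal_mul, ENNReal.toReal_inv, ENNReal.toReal_ofReal (h0 _),
    ENNReal.toReal_ofReal (h0 _), div_eq_mul_inv]

end PlaneTree

/-! ### Laws supported on a finite set -/

section FiniteSupport

variable {α : Type*} [MeasurableSpace α] [MeasurableSingletonClass α]

open Classical in
theorem measureReal_eq_sum_of_compl_eq_zero (μ : Measure α) [IsFiniteMeasure μ] {F : Finset α}
    (hF : μ (F : Set α)ᶜ = 0) (A : Set α) : μ.real A = ∑ a ∈ F with a ∈ A, μ.real {a} := by
  rw [sum_measureReal_singleton, Measure.real, Measure.real, ← measure_inter_conull hF]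
  congr 2
  ext a
  simp [and_comm]

theorem ext_of_finite_support {μ ν : ProbabilityMeasure α} {F : Finset α}
    (hμ : (μ : Measure α) (F : Set α)ᶜ = 0) (hν : (ν : Measure α) (F : Set α)ᶜ = 0)
    (h : ∀ a ∈ F, (μ : Measure α).real {a} = (ν : Measure α).real {a}) : μ = ν := by
  classical
  apply Subtype.ext
  ext A _
  have hA : (μ : Measure α).real A = (ν : Measure α).real A := by
    rw [measureReal_eq_sum_of_compl_eq_zero _ hμ, measureReal_eq_sum_of_compl_eq_zero _ hν]
    exact Finset.sum_congr rfl fun a ha => h a (Finset.mem_filter.1 ha).1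
  exact (ENNReal.toReal_eq_toReal_iff' (measure_ne_top (μ : Measure α) A)
    (measure_ne_top (ν : Measure α) A)).1 hA

/-- On a finite set, pointwise convergence implies convergence in total variation. -/
theorem exists_tendsto_tvDistance {ι : Type*} {l : Filter ι} [l.NeBot]
    {ν : ι → ProbabilityMeasure α} {F : Finset α}
    (hν : ∀ i, (ν i : Measure α) (F : Set α)ᶜ = 0) {L : α → ℝ}
    (hL : ∀ a ∈ F, Tendsto (fun i => (ν i : Measure α).real {a}) l (𝓝 (L a))) :
    ∃ P : ProbabilityMeasure α, (P : Measure α) (F : Set α)ᶜ = 0 ∧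
      (∀ a ∈ F, (P : Measure α).real {a} = L a) ∧ Tendsto (fun i => tvDistance (ν i) P) l (𝓝 0) := by
  classical
  have hL0 : ∀ a ∈ F, 0 ≤ L a := fun a ha =>
    ge_of_tendsto' (hL a ha) fun i => measureReal_nonneg
  -- No mass is lost in the limit because `F` is finite.
  have hL1 : ∑ a ∈ F, L a = 1 := by
    refine tendsto_nhds_unique (tendsto_finsetSum F hL) ?_
    refine tendsto_const_nhds.congr fun i => ?_
    rw [sum_measureReal_singleton, Measure.real, (prob_compl_eq_zero_iff F.measurableSet).1 (hν i),
      ENNReal.toReal_one]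
  set P : Measure α := ∑ a ∈ F, ENNReal.ofReal (L a) • Measure.dirac a with hP
  have hPapply : ∀ A : Set α, MeasurableSet A →
      P A = ∑ a ∈ F, ENNReal.ofReal (L a) * A.indicator 1 a := fun A hA => by
    rw [hP, Measure.finsetSum_apply]
    exact Finset.sum_congr rfl fun a _ => by
      rw [Measure.smul_apply, Measure.dirac_apply' _ hA, smul_eq_mul]
  have hPprob : IsProbabilityMeasure P := ⟨by
    rw [hPapply _ MeasurableSet.univ]
    simp only [Set.indicator_univ, Pi.one_apply, mul_one]
    rw [← ENNReal.ofReal_sum_of_nonneg hL0, hL1, ENNReal.ofReal_one]⟩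
  have hPF : P (F : Set α)ᶜ = 0 := by
    rw [hPapply _ F.measurableSet.compl]
    exact Finset.sum_eq_zero fun a ha => by simp [ha]
  have hPs : ∀ a ∈ F, P.real {a} = L a := fun a ha => by
    rw [Measure.real, hPapply _ (measurableSet_singleton a), Finset.sum_eq_single a]
    · simp [hL0 a ha]
    · intro b _ hb
      simp [hb]
    · exact fun h => absurd ha h
  refine ⟨⟨P, hPprob⟩, hPF, hPs, ?_⟩
  have hbound : ∀ i, tvDistance (ν i) ⟨P, hPprob⟩ ≤
      ∑ a ∈ F, |(ν i : Measure α).real {a} - L a| := by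
    intro i
    have : Nonempty {A : Set α // MeasurableSet A} := ⟨⟨∅, MeasurableSet.empty⟩⟩
    refine ciSup_le fun A => ?_
    change |(ν i : Measure α).real A - P.real A| ≤ _
    rw [measureReal_eq_sum_of_compl_eq_zero _ (hν i), measureReal_eq_sum_of_compl_eq_zero P hPF,
      ← Finset.sum_sub_distrib]
    refine (Finset.abs_sum_le_sum_abs _ _).trans ?_
    calc _ = ∑ a ∈ F with a ∈ A.1, |(ν i : Measure α).real {a} - L a| :=
          Finset.sum_congr rfl fun a ha => by rw [hPs a (Finset.mem_filter.1 ha).1]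
      _ ≤ _ := Finset.sum_le_sum_of_subset_of_nonneg (Finset.filter_subset _ _)
          fun _ _ _ => abs_nonneg _
  have hnonneg : ∀ i, 0 ≤ tvDistance (ν i) ⟨P, hPprob⟩ := fun i =>
    Real.iSup_nonneg fun A => abs_nonneg _
  refine squeeze_zero hnonneg hbound ?_
  have := tendsto_finsetSum F fun a ha => ((hL a ha).sub_const (L a)).abs
  simpa using this

end FiniteSupport

/-! ### Laws of root neighbourhoods and cluster points -/

namespace PlaneTree

variable {D : ℕ}

theorem mapTrunc_apply (Q : ProbabilityMeasure (PlaneTree D)) (n : ℕ) {A : Set (PlaneTree D)}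
    (hA : MeasurableSet A) :
    (mapTrunc Q n : Measure (PlaneTree D)) A = (Q : Measure (PlaneTree D)) (trunc n ⁻¹' A) :=
  Measure.map_apply (measurable_trunc n) hA

theorem mapTrunc_compl_treesUpTo (Q : ProbabilityMeasure (PlaneTree D)) (n : ℕ) :
    (mapTrunc Q n : Measure (PlaneTree D)) (treesUpTo D n : Set (PlaneTree D))ᶜ = 0 := by
  rw [mapTrunc_apply Q n (Finset.measurableSet _).compl]
  have : trunc n ⁻¹' (treesUpTo D n : Set (PlaneTree D))ᶜ = ∅ := by
    ext T
    simpa using trunc_mem_treesUpTo n T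
  rw [this, measure_empty]

theorem tendsto_gibbs_trunc_preimage (hD : 1 ≤ D) (E : Fin (D + 1) → ℝ) (β : ℝ) {n : ℕ}
    {τ : PlaneTree D} {a : ℝ}
    (h : Tendsto (fun N => PowerSeries.coeff N (genFun E β {T | trunc n T = τ}) /
      PowerSeries.coeff N (genFun E β (Set.univ : Set (PlaneTree D)))) atTop (𝓝 a)) :
    Tendsto (fun N : ℕ+ => (mapTrunc (gibbs hD E β N) n : Measure (PlaneTree D)).real {τ}) atTop
      (𝓝 a) := by
  refine (h.comp tendsto_PNat_val_atTop_atTop).congr fun N => ?_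
  have hm : MeasurableSet (trunc n ⁻¹' {τ}) := measurable_trunc n (measurableSet_singleton τ)
  rw [Measure.real, mapTrunc_apply _ n (measurableSet_singleton τ)]
  exact (gibbs_real_apply hD E β N hm).symm

theorem generateFrom_trunc : (instMeasurableSpace : MeasurableSpace (PlaneTree D)) =
    MeasurableSpace.generateFrom
      {S | ∃ (n : ℕ+) (A : Set (PlaneTree D)), MeasurableSet A ∧ S = trunc n ⁻¹' A} := by
  apply le_antisymm
  · refine (@measurable_iff_comap_le _ _ (MeasurableSpace.generateFrom _) _ code).1
      (@measurable_pi_lambda _ _ _ (MeasurableSpace.generateFrom _) _ _ fun m => ?_)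
    intro B hB
    refine MeasurableSpace.measurableSet_generateFrom
      ⟨⟨m + 1, Nat.succ_pos m⟩, (fun T => code T m) ⁻¹' B,
        (measurable_pi_apply m).comp measurable_code hB, ?_⟩
    ext T
    simp [code_trunc]
  · refine MeasurableSpace.generateFrom_le ?_
    rintro _ ⟨n, A, hA, rfl⟩
    exact measurable_trunc n hA

theorem isPiSystem_trunc : IsPiSystem
    {S : Set (PlaneTree D) | ∃ (n : ℕ+) (A : Set (PlaneTree D)), MeasurableSet A ∧
      S = trunc n ⁻¹' A} := by
  rintro _ ⟨n, A, hA, rfl⟩ _ ⟨m, B, hB, rfl⟩ -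
  refine ⟨max n m, trunc n ⁻¹' A ∩ trunc m ⁻¹' B,
    (measurable_trunc n hA).inter (measurable_trunc m hB), ?_⟩
  have hn : (n : ℕ) ≤ (max n m : ℕ+) := PNat.coe_le_coe _ _ |>.2 (le_max_left n m)
  have hm : (m : ℕ) ≤ (max n m : ℕ+) := PNat.coe_le_coe _ _ |>.2 (le_max_right n m)
  ext T
  simp only [Set.mem_inter_iff, Set.mem_preimage, trunc_trunc_of_le hn, trunc_trunc_of_le hm]

/-- A measure on plane trees is determined by the laws of the root neighbourhoods. -/
theorem measure_ext_trunc {Q R : Measure (PlaneTree D)} [IsProbabilityMeasure R]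
    (h : ∀ n : ℕ+, Q.map (trunc n) = R.map (trunc n)) : Q = R := by
  have hS : ∀ (n : ℕ+) (A : Set (PlaneTree D)), MeasurableSet A →
      R (trunc n ⁻¹' A) = Q (trunc n ⁻¹' A) := fun n A hA => by
    rw [← Measure.map_apply (measurable_trunc n) hA, ← h n,
      Measure.map_apply (measurable_trunc n) hA]
  refine (ext_of_generate_finite (m0 := instMeasurableSpace) (μ := R) (ν := Q) _
    generateFrom_trunc isPiSystem_trunc ?_ ?_).symm
  · rintro _ ⟨n, A, hA, rfl⟩
    exact hS n A hA
  · exact hS 1 Set.univ MeasurableSet.univ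

/-- Cluster points of a sequence of laws whose root neighbourhoods converge. -/
theorem exists_tendsto_ultrafilter {μ : ℕ+ → ProbabilityMeasure (PlaneTree D)}
    {P : ℕ+ → ProbabilityMeasure (PlaneTree D)}
    (hP : ∀ n : ℕ+, (P n : Measure (PlaneTree D)) (treesUpTo D n : Set (PlaneTree D))ᶜ = 0)
    (hlim : ∀ (n : ℕ+), ∀ τ ∈ treesUpTo D n,
      Tendsto (fun N => (mapTrunc (μ N) n : Measure (PlaneTree D)).real {τ}) atTop
        (𝓝 ((P n : Measure (PlaneTree D)).real {τ})))
    (u : Ultrafilter ℕ+) (hu : ↑u ≤ (atTop : Filter ℕ+)) :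
    ∃ R : ProbabilityMeasure (PlaneTree D), (∀ n : ℕ+, mapTrunc R n = P n) ∧
      Tendsto (fun N => toCodeSpace (μ N)) u (𝓝 (toCodeSpace R)) := by
  -- The probability measures on the compact space `𝕏` form a compact space, so a limit exists along
  -- every ultrafilter.
  obtain ⟨ν, -, hν⟩ := isCompact_univ.ultrafilter_le_nhds
    (u.map fun N => toCodeSpace (μ N)) (by simp)
  have hν' : Tendsto (fun N => toCodeSpace (μ N)) u (𝓝 ν) := hν
  have hclopen : ∀ B : Set (CodeSpace D), IsClopen B →
      Tendsto (fun N => (μ N : Measure (PlaneTree D)) (code ⁻¹' B)) u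
        (𝓝 ((ν : Measure (CodeSpace D)) B)) := fun B hB => by
    have h := ProbabilityMeasure.tendsto_measure_of_null_frontier_of_tendsto' hν' (E := B)
      (by rw [hB.frontier_eq, measure_empty])
    refine h.congr fun N => ?_
    exact Measure.map_apply measurable_code hB.isOpen.measurableSet
  -- Each clopen set in `range_code` has mass one under every `μ N`. Clopen sets have empty
  -- frontier, so this passes to `ν`, and a countable intersection keeps it.
  have hrange : (ν : Measure (CodeSpace D)) (Set.range (code : PlaneTree D → CodeSpace D))ᶜ = 0 := by
    rw [range_code, Set.compl_iInter, measure_iUnion_null_iff]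
    intro n
    have hc := isClopen_biUnion_cylinder (D := D) n
    rw [prob_compl_eq_zero_iff hc.isOpen.measurableSet]
    refine tendsto_nhds_unique (hclopen _ hc) ?_
    refine tendsto_const_nhds.congr fun N => ?_
    have : code ⁻¹' (⋃ τ ∈ treesUpTo D n, cylinder n τ.code) = Set.univ := by
      rw [Set.eq_univ_iff_forall]
      intro T
      have := Set.mem_range_self (f := (code : PlaneTree D → CodeSpace D)) T
      rw [range_code] at this
      exact Set.mem_iInter.1 this n
    rw [this, measure_univ]
  have hemb := measurableEmbedding_code (D := D)
  -- As `ν` lives on the codes of trees, it is the image of its pullback to trees.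
  have hmap : (Measure.comap code (ν : Measure (CodeSpace D))).map
      (code : PlaneTree D → CodeSpace D) = ν := by
    rw [hemb.map_comap]
    exact Measure.restrict_eq_self_of_ae_mem (mem_ae_iff.2 hrange)
  have hcomap : ∀ B : Set (CodeSpace D), MeasurableSet B →
      Measure.comap code (ν : Measure (CodeSpace D)) (code ⁻¹' B : Set (PlaneTree D)) =
        (ν : Measure (CodeSpace D)) B := fun B hB => by
    conv_rhs => rw [← hmap]
    rw [Measure.map_apply measurable_code hB]
  have hprob : IsProbabilityMeasure
      (Measure.comap (code : PlaneTree D → CodeSpace D) (ν : Measure (CodeSpace D))) := ⟨by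
    have := hcomap Set.univ MeasurableSet.univ
    rw [Set.preimage_univ] at this
    exact this.trans measure_univ⟩
  refine ⟨⟨_, hprob⟩, fun n => ?_, ?_⟩
  · refine ext_of_finite_support (mapTrunc_compl_treesUpTo _ n) (hP n) fun τ hτ => ?_
    have hτ' := mem_treesUpTo.1 hτ
    refine tendsto_nhds_unique ?_ ((hlim n τ hτ).mono_left hu)
    have hc := isClopen_cylinder (n : ℕ) τ.code
    have h := (ENNReal.tendsto_toReal (measure_ne_top _ _)).comp (hclopen _ hc)
    rw [← hcomap _ hc.isOpen.measurableSet, ← trunc_preimage_singleton hτ',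
      ← Measure.map_apply (measurable_trunc n) (measurableSet_singleton τ)] at h
    refine h.congr fun N => ?_
    rw [Function.comp_apply, Measure.real, mapTrunc_apply _ _ (measurableSet_singleton τ)]
  · have : toCodeSpace (⟨_, hprob⟩ : ProbabilityMeasure (PlaneTree D)) = ν := Subtype.ext hmap
    rw [this]
    exact hν'

/-- A finite tree with heights at most `b` has no vertex of height `b + 1`, so its neighbourhood of
radius `b + 1` does not have height `b + 1`. -/
theorem compl_infiniteTrees_subset : (infiniteTrees D)ᶜ ⊆
    ⋃ n : ℕ+, trunc n ⁻¹' (ofHeight D n)ᶜ := by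
  intro T hT
  have hfin : T.verts.Finite := Set.not_infinite.1 hT
  obtain ⟨b, hb⟩ := (hfin.image List.length).bddAbove
  refine Set.mem_iUnion.2 ⟨⟨b + 1, Nat.succ_pos b⟩, fun h => ?_⟩
  obtain ⟨v, hv, hvb⟩ := h.1
  have : v.length ≤ b := hb ⟨v, hv.1, rfl⟩
  simp only [PNat.mk_coe] at hvb
  omega

end PlaneTree

end

/-! ### Proof of the theorem -/

theorem theorem7 (D : ℕ) (hD : 1 ≤ D) (E : Fin (D + 1) → ℝ) (β : ℝ) :
    ∃ (P : ℕ+ → ProbabilityMeasure (PlaneTree D)) (Pinf : ProbabilityMeasure (PlaneTree D)),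
      -- `P n` is the limit in total variation of `μ_N π_n^{-1}`, and lives on trees of height `n`
      (∀ n : ℕ+, (P n : Measure (PlaneTree D)) (PlaneTree.ofHeight D n)ᶜ = 0 ∧
        Tendsto (fun N : ℕ+ => tvDistance (PlaneTree.mapTrunc (PlaneTree.gibbs hD E β N) n) (P n))
          atTop (𝓝 0)) ∧
      -- the explicit form of `P n`
      (2 ≤ D → ∃ p ∈ meanOneSimplex D, IsMinOn (freeEnergy E β) (meanOneSimplex D) p ∧
        ∃ C ρ : ℝ, 0 < C ∧ 0 < ρ ∧
          (∀ i : Fin (D + 1), p i = C * Real.exp (-β * E i) * ρ ^ (i : ℕ)) ∧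
          ∀ n : ℕ+, ∀ τ ∈ PlaneTree.ofHeight D n,
            (P n : Measure (PlaneTree D)).real {τ} =
              C * τ.numAt n * Real.exp (-β * τ.innerEnergy E n) * ρ ^ τ.numAt n *
                Real.exp (freeEnergy E β p) ^ (τ.numBelow n - 1)) ∧
      -- `Pinf` is the unique measure on plane trees consistent with all `P n`
      (∀ n : ℕ+, PlaneTree.mapTrunc Pinf n = P n) ∧
      (∀ Q : Measure (PlaneTree D),
        (∀ n : ℕ+, Q.map (PlaneTree.trunc n) = (P n : Measure (PlaneTree D))) →
          Q = (Pinf : Measure (PlaneTree D))) ∧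
      (Pinf : Measure (PlaneTree D)) (PlaneTree.infiniteTrees D)ᶜ = 0 ∧
      -- weak convergence on the product space
      Tendsto (fun N : ℕ+ => PlaneTree.toCodeSpace (PlaneTree.gibbs hD E β N)) atTop
        (𝓝 (PlaneTree.toCodeSpace Pinf)) := by
  obtain ⟨L, hL, hL0, hLform⟩ := PlaneTree.exists_tendsto_coeff_genFun hD E β
  have hlimL : ∀ (n : ℕ+), ∀ τ ∈ PlaneTree.treesUpTo D n, Tendsto (fun N : ℕ+ =>
      (PlaneTree.mapTrunc (PlaneTree.gibbs hD E β N) n : Measure (PlaneTree D)).real {τ}) atTop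
      (𝓝 (L n τ)) := fun n τ hτ =>
    PlaneTree.tendsto_gibbs_trunc_preimage hD E β (hL n τ (PlaneTree.mem_treesUpTo.1 hτ))
  choose P hPF hPL hPtv using fun n : ℕ+ => exists_tendsto_tvDistance
    (fun N => PlaneTree.mapTrunc_compl_treesUpTo (PlaneTree.gibbs hD E β N) n) (hlimL n)
  have hlimP : ∀ (n : ℕ+), ∀ τ ∈ PlaneTree.treesUpTo D n, Tendsto (fun N : ℕ+ =>
      (PlaneTree.mapTrunc (PlaneTree.gibbs hD E β N) n : Measure (PlaneTree D)).real {τ}) atTop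
      (𝓝 ((P n : Measure (PlaneTree D)).real {τ})) := fun n τ hτ => by
    rw [hPL n τ hτ]
    exact hlimL n τ hτ
  -- The limit weight vanishes for trees of height less than `n`, as these have no vertex at height
  -- `n`.
  have hheight : ∀ n : ℕ+, (P n : Measure (PlaneTree D)) (PlaneTree.ofHeight D n)ᶜ = 0 := by
    intro n
    rw [← measureReal_eq_zero_iff, measureReal_eq_sum_of_compl_eq_zero _ (hPF n)]
    refine Finset.sum_eq_zero fun τ hτ => ?_
    simp only [Finset.mem_filter] at hτ
    rw [hPL n τ hτ.1]
    exact hL0 n τ (PlaneTree.numAt_eq_zero_of_notMem_ofHeight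
      (PlaneTree.mem_treesUpTo.1 hτ.1) hτ.2)
  have hcluster := PlaneTree.exists_tendsto_ultrafilter hPF hlimP
  obtain ⟨Pinf, hPinf, -⟩ := hcluster (Ultrafilter.of atTop) (Ultrafilter.of_le _)
  have hPinf' : ∀ n : ℕ+, (Pinf : Measure (PlaneTree D)).map (PlaneTree.trunc n) = P n :=
    fun n => congrArg Subtype.val (hPinf n)
  have huniq : ∀ Q : Measure (PlaneTree D),
      (∀ n : ℕ+, Q.map (PlaneTree.trunc n) = (P n : Measure (PlaneTree D))) →
        Q = (Pinf : Measure (PlaneTree D)) := fun Q hQ =>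
    PlaneTree.measure_ext_trunc fun n => (hQ n).trans (hPinf' n).symm
  refine ⟨P, Pinf, fun n => ⟨hheight n, hPtv n⟩, fun h2 => ?_, hPinf, huniq, ?_, ?_⟩
  · obtain ⟨p, hpΔ, hmin, C, ρ, hC, hρ, hp, hform⟩ := hLform h2
    refine ⟨p, hpΔ, hmin, C, ρ, hC, hρ, hp, fun n τ hτ => ?_⟩
    rw [hPL n τ (PlaneTree.mem_treesUpTo.2 (PlaneTree.trunc_eq_of_mem_ofHeight hτ)),
      hform n τ n.pos]
  · refine measure_mono_null PlaneTree.compl_infiniteTrees_subset (measure_iUnion_null fun n => ?_)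
    -- The inequality between the mass of a preimage and the image measure needs no measurability of
    -- `ofHeight D n`.
    refine le_antisymm ((Measure.le_map_apply
      (PlaneTree.measurable_trunc n).aemeasurable _).trans ?_) zero_le
    rw [hPinf' n, hheight n]
  -- Along every ultrafilter the limit is a law consistent with all `P n`, hence `Pinf` by
  -- uniqueness.
  · rw [tendsto_iff_ultrafilter]
    intro u hu
    obtain ⟨R, hR, hRlim⟩ := hcluster u hu
    have hRP : R = Pinf := Subtype.ext (huniq R fun n => congrArg Subtype.val (hR n))
    rwa [hRP] at hRlim
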